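/- All Lie algebras are real. Each of the seven-dimensional Lie algebras below has a basis $X_1,\dots,X_7$ and brackets $[X_i,X_j]=\sum_k C_{ij}^k X_k$; brackets that are not listed are zero or follow by antisymmetry. Write $(\mathfrak{so})$ for $C_{23}^1=1,\ C_{12}^3=1,\ C_{13}^2=-1$; $(\mathfrak{sl})$ for $C_{12}^2=2,\ C_{13}^3=-2,\ C_{23}^1=1$; and $(D)$ for $C_{14}^4=1,\ C_{15}^5=-1,\ C_{25}^4=1,\ C_{34}^5=1$. - $L_{7,1}$: $(\mathfrak{so})$, $C_{15}^6=1,\ C_{16}^5=-1,\ C_{24}^6=-1,\ C_{26}^4=1,\ C_{34}^5=1,\ C_{35}^4=-1,\ C_{47}^4=C_{57}^5=C_{67}^6=1$. - $L_{7,2}$: $(\mathfrak{so})$, $C_{14}^7=C_{15}^6=C_{24}^5=C_{26}^7=C_{34}^6=C_{37}^5=\tfrac12$, $C_{16}^5=C_{17}^4=C_{25}^4=C_{27}^6=C_{35}^7=C_{36}^4=-\tfrac12$. - $L_{7,3}^p$ ($p\in\mathbb{R}$, $p\neq0$): $(\mathfrak{sl})$, $(D)$, $C_{47}^4=C_{57}^5=1,\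 C_{67}^6=p$. - $L_{7,4}$: $(\mathfrak{sl})$, $(D)$, $C_{45}^6=1,\ C_{47}^4=C_{57}^5=1,\ C_{67}^6=2$. - $L_{7,5}$: $(\mathfrak{sl})$, $C_{14}^4=2,\ C_{16}^6=-2,\ C_{25}^4=2,\ C_{26}^5=1,\ C_{34}^5=1,\ C_{35}^6=2,\ C_{47}^4=C_{57}^5=C_{67}^6=1$. - $L_{7,6}$: $(\mathfrak{sl})$, $C_{14}^4=3,\ C_{15}^5=1,\ C_{16}^6=-1,\ C_{17}^7=-3,\ C_{25}^4=3,\ C_{26}^5=2,\ C_{27}^6=1,\ C_{34}^5=1,\ C_{35}^6=2,\ C_{36}^7=3$. - $L_{7,7}$: $(\mathfrak{sl})$, $(D)$, $C_{16}^6=1,\ C_{17}^7=-1,\ C_{27}^6=1,\ C_{36}^7=1$. Let $H^2(\mathfrak g,\mathfrak g)$ be the second Chevalley–Eilenberg cohomology of $\mathfrak g$ with values in the adjoint module. An $n$-dimensional Lie algebra is called stable if its orbit under $GL(n,\mathbb{R})$ is open in the variety of all Lie algebra laws on $\mathbb{R}^n$ (the set of structure tensors $(C_{ij}^k)$ of Lie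 brackets, with the subspace topology). **Proposition.** For $j\in\{1,2,4,5,6,7\}$, $H^2(L_{7,j},L_{7,j})=0$ and $L_{7,j}$ is stable. For $p\neq0$, $$\dim H^2(L_{7,3}^p,L_{7,3}^p)=\begin{cases}1,& p\neq 2,\\ 2,& p=2.\end{cases}$$ Moreover, let $\varphi_1,\varphi_2$ be the alternating bilinear maps with $\varphi_1(X_6,X_7)=X_6$ and $\varphi_2(X_4,X_5)=X_6$, all other values on pairs $X_i,X_j$ with $i<j$ being zero. If $p\neq0,2$, then $\varphi_1$ is a $2$-cocycle of $L_{7,3}^p$ and $[\varphi_1]$ spans $H^2(L_{7,3}^p,L_{7,3}^p)$; if $p=2$, then $\varphi_1$ and $\varphi_2$ are $2$-cocycles of $L_{7,3}^2$ and $[\varphi_1],[\varphi_2]$ span $H^2(L_{7,3}^2,L_{7,3}^2)$. -/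

import Mathlib

-- Mathlib's own project-wide value of this option.
set_option maxSynthPendingDepth 3

open LieModule.Cohomology

noncomputable section

/-- The bilinear map `ℝⁿ × ℝⁿ → ℝⁿ` with coordinates `C`:
`(X_i, X_j) ↦ ∑ k, C i j k • X_k` on the standard basis. -/
def tensorMap {n : ℕ} (C : Fin n → Fin n → Fin n → ℝ) :
    (Fin n → ℝ) →ₗ[ℝ] (Fin n → ℝ) →ₗ[ℝ] (Fin n → ℝ) :=
  LinearMap.mk₂ ℝ (fun x y k => ∑ i, ∑ j, C i j k * x i * y j)
    (fun x x' y => by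
      ext k; simp only [Pi.add_apply, mul_add, add_mul, Finset.sum_add_distrib])
    (fun c x y => by
      ext k; simp only [Pi.smul_apply, smul_eq_mul, Finset.mul_sum]
      exact Finset.sum_congr rfl fun i _ => Finset.sum_congr rfl fun j _ => by ring)
    (fun x y y' => by
      ext k; simp only [Pi.add_apply, mul_add, Finset.sum_add_distrib])
    (fun c x y => by
      ext k; simp only [Pi.smul_apply, smul_eq_mul, Finset.mul_sum]
      exact Finset.sum_congr rfl fun i _ => Finset.sum_congr rfl fun j _ => by ring)

theorem tensorMap_apply {n : ℕ} (C : Fin n → Fin n → Fin n → ℝ) (x y : Fin n → ℝ) (k : Fin n) :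
    tensorMap C x y k = ∑ i, ∑ j, C i j k * x i * y j := rfl

/-- The variety of real Lie algebra laws on `ℝⁿ`, in coordinates: the structure tensors of
alternating bilinear maps that satisfy the Jacobi identity. -/
def LieLaw (n : ℕ) : Type :=
  {C : Fin n → Fin n → Fin n → ℝ //
    (∀ x, tensorMap C x x = 0) ∧
    ∀ x y z, tensorMap C x (tensorMap C y z) + tensorMap C y (tensorMap C z x) +
      tensorMap C z (tensorMap C x y) = 0}

/-- The variety of laws carries the subspace topology of the space of structure tensors. -/
instance (n : ℕ) : TopologicalSpace (LieLaw n) :=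
  inferInstanceAs (TopologicalSpace (Subtype _))

namespace LieLaw

variable {n : ℕ}

/-- The bracket of a Lie algebra law. -/
def bracket (μ : LieLaw n) : (Fin n → ℝ) →ₗ[ℝ] (Fin n → ℝ) →ₗ[ℝ] (Fin n → ℝ) :=
  tensorMap μ.1

/-- The orbit of a law under the action of the general linear group of `ℝⁿ` on the variety of
laws, i.e. the set of all laws isomorphic to it. -/
def orbit (μ : LieLaw n) : Set (LieLaw n) :=
  {ν | ∃ g : (Fin n → ℝ) ≃ₗ[ℝ] (Fin n → ℝ),
    ∀ x y, ν.bracket x y = g (μ.bracket (g.symm x) (g.symm y))}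

/-- A Lie algebra is stable if its orbit is open in the variety of laws. -/
def IsStable (μ : LieLaw n) : Prop := IsOpen μ.orbit

/-- The Lie algebra `(ℝⁿ, μ)`. -/
def Alg (_μ : LieLaw n) : Type := Fin n → ℝ

instance (μ : LieLaw n) : AddCommGroup μ.Alg := inferInstanceAs (AddCommGroup (Fin n → ℝ))

instance (μ : LieLaw n) : Module ℝ μ.Alg := inferInstanceAs (Module ℝ (Fin n → ℝ))

theorem bracket_skew (μ : LieLaw n) (x y : Fin n → ℝ) : μ.bracket x y = -μ.bracket y x := by
  have h := μ.2.1 (x + y)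
  have hx := μ.2.1 x
  have hy := μ.2.1 y
  simp only [map_add, LinearMap.add_apply, hx, hy, zero_add, add_zero] at h
  rw [add_comm] at h
  exact eq_neg_of_add_eq_zero_left h

instance (μ : LieLaw n) : LieRing μ.Alg where
  bracket x y := μ.bracket x y
  add_lie x y z := LinearMap.congr_fun (map_add μ.bracket x y) z
  lie_add x y z := map_add (μ.bracket x) y z
  lie_self x := μ.2.1 x
  leibniz_lie x y z := by
    change μ.bracket x (μ.bracket y z) =
      μ.bracket (μ.bracket x y) z + μ.bracket y (μ.bracket x z)
    have h : μ.bracket x (μ.bracket y z) + μ.bracket y (μ.bracket z x) +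
      μ.bracket z (μ.bracket x y) = 0 := μ.2.2 x y z
    rw [bracket_skew μ (μ.bracket x y) z, bracket_skew μ x z, map_neg]
    rw [add_assoc] at h
    rw [eq_neg_of_add_eq_zero_left h]
    abel

instance (μ : LieLaw n) : LieAlgebra ℝ μ.Alg where
  lie_smul c x y := map_smul (μ.bracket x) c y

end LieLaw

section Cohomology

variable (L : Type*) [LieRing L] [LieAlgebra ℝ L]

/-- The 2-coboundaries of `L` with values in the adjoint module, inside the 2-cocycles
(every coboundary is a cocycle). -/
def adjointCoboundaries : Submodule ℝ (twoCocycle ℝ L L) :=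
  (LinearMap.range (d₁₂ ℝ L L)).submoduleOf (twoCocycle ℝ L L)

/-- The second adjoint cohomology space `H²(L, L) = Z²(L, L) / B²(L, L)`. -/
abbrev AdjointH2 : Type _ := twoCocycle ℝ L L ⧸ adjointCoboundaries L

end Cohomology

/-- The cohomology class of a 2-cocycle. -/
def cohomologyClass {L : Type*} [LieRing L] [LieAlgebra ℝ L] (φ : twoCochain ℝ L L)
    (hφ : φ ∈ twoCocycle ℝ L L) : AdjointH2 L :=
  Submodule.Quotient.mk ⟨φ, hφ⟩


section Tables

variable {n : ℕ}

/-- The structure tensor given by a table of entries `(i, j, k, v)`, each of which stands for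
`C_{ij}^k = v`. Indices in the table run from `1` to `n`; values not listed are zero or obtained
by antisymmetry. -/
def tableTensor (l : List (ℕ × ℕ × ℕ × ℝ)) (i j k : Fin n) : ℝ :=
  (l.map fun e =>
    (if i.val + 1 = e.1 ∧ j.val + 1 = e.2.1 ∧ k.val + 1 = e.2.2.1 then e.2.2.2 else 0) -
    (if j.val + 1 = e.1 ∧ i.val + 1 = e.2.1 ∧ k.val + 1 = e.2.2.1 then e.2.2.2 else 0)).sum

/-- The coordinate of `x` with label `a ∈ {1, …, n}`. -/
def coord (x : Fin n → ℝ) (a : ℕ) : ℝ := ∑ i : Fin n, if i.val + 1 = a then x i else 0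

theorem tensorMap_tableTensor (l : List (ℕ × ℕ × ℕ × ℝ)) (x y : Fin n → ℝ) (k : Fin n) :
    tensorMap (tableTensor l) x y k =
      (l.map fun e => if k.val + 1 = e.2.2.1 then
        e.2.2.2 * (coord x e.1 * coord y e.2.1 - coord x e.2.1 * coord y e.1) else 0).sum := by
  rw [tensorMap_apply]
  induction l with
  | nil => simp [tableTensor]
  | cons e l ih =>
    have h : ∀ i j : Fin n, tableTensor (e :: l) i j k =
      ((if i.val + 1 = e.1 ∧ j.val + 1 = e.2.1 ∧ k.val + 1 = e.2.2.1 then e.2.2.2 else 0) -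
      (if j.val + 1 = e.1 ∧ i.val + 1 = e.2.1 ∧ k.val + 1 = e.2.2.1 then e.2.2.2 else 0)) +
      tableTensor l i j k := fun i j => by simp [tableTensor]
    simp only [h, add_mul, Finset.sum_add_distrib, ih, List.map_cons, List.sum_cons]
    congr 1
    split_ifs with hk
    · simp only [coord, Finset.sum_mul_sum]
      simp only [← Finset.sum_sub_distrib, Finset.mul_sum, hk, and_true]
      refine Finset.sum_congr rfl fun i _ => Finset.sum_congr rfl fun j _ => ?_
      simp only [ite_and]
      split_ifs <;> ring
    · simp [hk]

theorem tensorMap_tableTensor_self (l : List (ℕ × ℕ × ℕ × ℝ)) (x : Fin n → ℝ) :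
    tensorMap (tableTensor l) x x = 0 := by
  ext k
  rw [tensorMap_tableTensor]
  apply List.sum_eq_zero
  intro a ha
  obtain ⟨e, -, rfl⟩ := List.mem_map.1 ha
  split_ifs <;> simp [mul_comm]

/-- The 2-cochain `φ(X_i, X_j) = ∑ k, C_{ij}^k X_k` of `(ℝⁿ, μ)` given by a table. -/
def tableCochain (μ : LieLaw n) (l : List (ℕ × ℕ × ℕ × ℝ)) : twoCochain ℝ μ.Alg μ.Alg :=
  ⟨(tensorMap (n := n) (tableTensor l) :
      (Fin n → ℝ) →ₗ[ℝ] (Fin n → ℝ) →ₗ[ℝ] (Fin n → ℝ)), tensorMap_tableTensor_self l⟩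

theorem coord_seven (x : Fin 7 → ℝ) :
    coord x 1 = x 0 ∧ coord x 2 = x 1 ∧ coord x 3 = x 2 ∧ coord x 4 = x 3 ∧ coord x 5 = x 4 ∧
      coord x 6 = x 5 ∧ coord x 7 = x 6 := by
  simp [coord, Fin.sum_univ_seven]

end Tables

/-! ### The seven-dimensional indecomposable Lie algebras with nontrivial Levi decomposition -/

/-- Structure constants of `so(3)`. -/
def so3Table : List (ℕ × ℕ × ℕ × ℝ) := [(2, 3, 1, 1), (1, 2, 3, 1), (1, 3, 2, -1)]

/-- Structure constants of `sl(2, ℝ)`. -/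
def sl2Table : List (ℕ × ℕ × ℕ × ℝ) := [(1, 2, 2, 2), (1, 3, 3, -2), (2, 3, 1, 1)]

/-- `L_{7,1}`. -/
def L71 : LieLaw 7 :=
  ⟨tableTensor (so3Table ++
    [(1, 5, 6, 1), (1, 6, 5, -1), (2, 4, 6, -1), (2, 6, 4, 1), (3, 4, 5, 1), (3, 5, 4, -1),
     (4, 7, 4, 1), (5, 7, 5, 1), (6, 7, 6, 1)]),
    tensorMap_tableTensor_self _, by
    intro x y z
    ext k
    fin_cases k <;> simp [tensorMap_tableTensor, so3Table, coord_seven] <;> ring⟩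

/-- `L_{7,2}`. -/
def L72 : LieLaw 7 :=
  ⟨tableTensor (so3Table ++
    [(1, 4, 7, 1/2), (1, 5, 6, 1/2), (1, 6, 5, -1/2), (1, 7, 4, -1/2),
     (2, 4, 5, 1/2), (2, 5, 4, -1/2), (2, 6, 7, 1/2), (2, 7, 6, -1/2),
     (3, 4, 6, 1/2), (3, 5, 7, -1/2), (3, 6, 4, -1/2), (3, 7, 5, 1/2)]),
    tensorMap_tableTensor_self _, by
    intro x y z
    ext k
    fin_cases k <;> simp [tensorMap_tableTensor, so3Table, coord_seven] <;> ring⟩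

/-- `L_{7,3}^p` (the family has `p ≠ 0`). -/
def L73 (p : ℝ) : LieLaw 7 :=
  ⟨tableTensor (sl2Table ++
    [(1, 4, 4, 1), (1, 5, 5, -1), (2, 5, 4, 1), (3, 4, 5, 1),
     (4, 7, 4, 1), (5, 7, 5, 1), (6, 7, 6, p)]),
    tensorMap_tableTensor_self _, by
    intro x y z
    ext k
    fin_cases k <;> simp [tensorMap_tableTensor, sl2Table, coord_seven] <;> ring⟩

/-- `L_{7,4}`. -/
def L74 : LieLaw 7 :=
  ⟨tableTensor (sl2Table ++
    [(1, 4, 4, 1), (1, 5, 5, -1), (2, 5, 4, 1), (3, 4, 5, 1),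
     (4, 5, 6, 1), (4, 7, 4, 1), (5, 7, 5, 1), (6, 7, 6, 2)]),
    tensorMap_tableTensor_self _, by
    intro x y z
    ext k
    fin_cases k <;> simp [tensorMap_tableTensor, sl2Table, coord_seven] <;> ring⟩

/-- `L_{7,5}`. -/
def L75 : LieLaw 7 :=
  ⟨tableTensor (sl2Table ++
    [(1, 4, 4, 2), (1, 6, 6, -2), (2, 5, 4, 2), (2, 6, 5, 1), (3, 4, 5, 1), (3, 5, 6, 2),
     (4, 7, 4, 1), (5, 7, 5, 1), (6, 7, 6, 1)]),
    tensorMap_tableTensor_self _, by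
    intro x y z
    ext k
    fin_cases k <;> simp [tensorMap_tableTensor, sl2Table, coord_seven] <;> ring⟩

/-- `L_{7,6}`. -/
def L76 : LieLaw 7 :=
  ⟨tableTensor (sl2Table ++
    [(1, 4, 4, 3), (1, 5, 5, 1), (1, 6, 6, -1), (1, 7, 7, -3),
     (2, 5, 4, 3), (2, 6, 5, 2), (2, 7, 6, 1),
     (3, 4, 5, 1), (3, 5, 6, 2), (3, 6, 7, 3)]),
    tensorMap_tableTensor_self _, by
    intro x y z
    ext k
    fin_cases k <;> simp [tensorMap_tableTensor, sl2Table, coord_seven] <;> ring⟩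

/-- `L_{7,7}`. -/
def L77 : LieLaw 7 :=
  ⟨tableTensor (sl2Table ++
    [(1, 4, 4, 1), (1, 5, 5, -1), (2, 5, 4, 1), (3, 4, 5, 1),
     (1, 6, 6, 1), (1, 7, 7, -1), (2, 7, 6, 1), (3, 6, 7, 1)]),
    tensorMap_tableTensor_self _, by
    intro x y z
    ext k
    fin_cases k <;> simp [tensorMap_tableTensor, sl2Table, coord_seven] <;> ring⟩

/-- The 2-cochain of `L_{7,3}^p` with `φ₁(X₆, X₇) = X₆`. -/
def phi1 (p : ℝ) : twoCochain ℝ (L73 p).Alg (L73 p).Alg := tableCochain (L73 p) [(6, 7, 6, 1)]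

/-- The 2-cochain of `L_{7,3}^p` with `φ₂(X₄, X₅) = X₆`. -/
def phi2 (p : ℝ) : twoCochain ℝ (L73 p).Alg (L73 p).Alg := tableCochain (L73 p) [(4, 5, 6, 1)]

end

/-!
Let an inner product on a Lie algebra be given by an orthogonal basis. On cocycles the Lie
derivative along `x` is a coboundary, so if the transpose of `ad x` is again of the form `ad y`,
then `x` annihilates every cocycle orthogonal to the coboundaries. Hence each class of `H²` has a
representative invariant under a suitably placed Levi factor and under all elements acting
diagonally. On such a cocycle the contraction with an element of the Levi factor is a derivation,
inner because the Levi factor is perfect, and a coboundary makes it vanish. The few structure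
constants that are left satisfy a small linear system, which is solved for each algebra in turn.

For stability, the orbit map of a law and the equations of the variety of laws have the
Chevalley–Eilenberg differentials as derivatives at the law. If `H² = 0`, this sequence of
derivatives is exact, and the implicit function theorem shows that the orbit is a neighbourhood of
the law; the general linear group carries this to every point of the orbit.
-/

noncomputable section

open LinearMap (BilinForm IsAdjointPair)

/-! ### Invariant cocycles -/

section InducedForms

variable {M N ι : Type*} [AddCommGroup M] [Module ℝ M] [AddCommGroup N] [Module ℝ N]
  [Fintype ι] {b : Module.Basis ι ℝ M} {w : ι → ℝ} {B : BilinForm ℝ N}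

/-- The bilinear form on `M` for which the basis `b` is orthogonal and `b i` has square `w i`. -/
def diagForm (b : Module.Basis ι ℝ M) (w : ι → ℝ) : BilinForm ℝ M :=
  ∑ i, w i • (LinearMap.mul ℝ ℝ).compl₁₂ (b.coord i) (b.coord i)

/-- The bilinear form on `M →ₗ[ℝ] N` induced by the form `diagForm b w` on `M` and the form `B`
on `N`. -/
def homForm (b : Module.Basis ι ℝ M) (w : ι → ℝ) (B : BilinForm ℝ N) : BilinForm ℝ (M →ₗ[ℝ] N) :=
  ∑ i, (w i)⁻¹ • B.compl₁₂ (LinearMap.applyₗ (b i)) (LinearMap.applyₗ (b i))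

theorem diagForm_apply (b : Module.Basis ι ℝ M) (w : ι → ℝ) (x y : M) :
    diagForm b w x y = ∑ i, w i * (b.repr x i * b.repr y i) := by
  simp [diagForm]

theorem homForm_apply (b : Module.Basis ι ℝ M) (w : ι → ℝ) (B : BilinForm ℝ N) (f g : M →ₗ[ℝ] N) :
    homForm b w B f g = ∑ i, (w i)⁻¹ * B (f (b i)) (g (b i)) := by
  simp [homForm]

theorem diagForm_isSymm (b : Module.Basis ι ℝ M) (w : ι → ℝ) : (diagForm b w).IsSymm :=
  ⟨fun x y => by simp only [diagForm_apply, mul_comm (b.repr x _)]⟩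

theorem homForm_isSymm (b : Module.Basis ι ℝ M) (w : ι → ℝ) (hB : B.IsSymm) :
    (homForm b w B).IsSymm :=
  ⟨fun f g => by simp only [homForm_apply, hB.eq (f _)]⟩

theorem diagForm_self_pos (hw : ∀ i, 0 < w i) {x : M} (hx : x ≠ 0) : 0 < diagForm b w x x := by
  obtain ⟨i, hi⟩ : ∃ i, b.repr x i ≠ 0 := by
    by_contra! h
    exact hx (b.ext_elem fun i => by simp [h i])
  rw [diagForm_apply]
  exact Finset.sum_pos' (fun j _ => mul_nonneg (hw j).le (mul_self_nonneg _))
    ⟨i, Finset.mem_univ i, mul_pos (hw i) (mul_self_pos.2 hi)⟩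

theorem homForm_self_pos (hw : ∀ i, 0 < w i) (hB : ∀ y ≠ 0, 0 < B y y) {f : M →ₗ[ℝ] N}
    (hf : f ≠ 0) : 0 < homForm b w B f f := by
  have hB₀ (y : N) : 0 ≤ B y y := by
    obtain rfl | hy := eq_or_ne y 0
    exacts [by simp, (hB y hy).le]
  obtain ⟨i, hi⟩ : ∃ i, f (b i) ≠ 0 := by
    by_contra! h
    exact hf (b.ext fun i => by simp [h i])
  rw [homForm_apply]
  exact Finset.sum_pos' (fun j _ => mul_nonneg (inv_nonneg.2 (hw j).le) (hB₀ _))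
    ⟨i, Finset.mem_univ i, mul_pos (inv_pos.2 (hw i)) (hB _ hi)⟩

theorem diagForm_basis_left (b : Module.Basis ι ℝ M) (w : ι → ℝ) (i : ι) (x : M) :
    diagForm b w (b i) x = w i * b.repr x i := by
  classical
  simp [diagForm_apply, Finsupp.single_apply]

theorem homForm_comp_left (hw : ∀ i, 0 < w i) {S T : Module.End ℝ M}
    (h : IsAdjointPair (diagForm b w) (diagForm b w) S T) (f g : M →ₗ[ℝ] N) :
    homForm b w B (f ∘ₗ S) g = homForm b w B f (g ∘ₗ T) := by
  have hST (i j : ι) : (w i)⁻¹ * b.repr (S (b i)) j = (w j)⁻¹ * b.repr (T (b j)) i := by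
    have := h (b i) (b j)
    rw [(diagForm_isSymm b w).eq, diagForm_basis_left, diagForm_basis_left] at this
    have hi := (hw i).ne'
    have hj := (hw j).ne'
    field_simp
    linarith
  have expand (A : Module.End ℝ M) (k : M →ₗ[ℝ] N) (i : ι) :
      k (A (b i)) = ∑ j, b.repr (A (b i)) j • k (b j) := by
    conv_lhs => rw [← b.sum_repr (A (b i)), map_sum]
    simp only [map_smul]
  simp only [homForm_apply, LinearMap.comp_apply, expand, map_sum, LinearMap.sum_apply, map_smul,
    LinearMap.smul_apply, smul_eq_mul, Finset.mul_sum, ← mul_assoc, hST]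
  exact Finset.sum_comm

theorem homForm_comp_right {S T : Module.End ℝ N} (h : IsAdjointPair B B S T) (f g : M →ₗ[ℝ] N) :
    homForm b w B (S ∘ₗ f) g = homForm b w B f (T ∘ₗ g) := by
  simp only [homForm_apply, LinearMap.comp_apply, h _ _]

end InducedForms

section InvariantComplement

variable {L M N : Type*} [LieRing L] [LieAlgebra ℝ L]
  [AddCommGroup M] [Module ℝ M] [LieRingModule L M] [LieModule ℝ L M]
  [AddCommGroup N] [Module ℝ N] [LieRingModule L N] [LieModule ℝ L N]

/-- The elements `x` and `y` of a Lie algebra act on a module by operators that are adjoint to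
each other with respect to the bilinear form `B`. -/
def LieAdjoint (B : BilinForm ℝ M) (x y : L) : Prop :=
  IsAdjointPair B B (LieModule.toEnd ℝ L M x) (LieModule.toEnd ℝ L M y)

theorem LieAdjoint.homForm {ι : Type*} [Fintype ι] {b : Module.Basis ι ℝ M} {w : ι → ℝ}
    (hw : ∀ i, 0 < w i) {B : BilinForm ℝ N} {x y : L} (hM : LieAdjoint (diagForm b w) x y)
    (hN : LieAdjoint B x y) : LieAdjoint (homForm b w B) x y := fun f g => by
  have lie_eq (z : L) (k : M →ₗ[ℝ] N) : LieModule.toEnd ℝ L (M →ₗ[ℝ] N) z k =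
      LieModule.toEnd ℝ L N z ∘ₗ k - k ∘ₗ LieModule.toEnd ℝ L M z := by
    ext; simp
  rw [lie_eq, lie_eq, map_sub, map_sub, LinearMap.sub_apply, homForm_comp_left hw hM,
    homForm_comp_right hN]

/-- The component `ψ` of `z` orthogonal to `U` is killed by every `x` that has an adjoint `y`,
because `B ⁅x, ψ⁆ ⁅x, ψ⁆ = B ψ ⁅y, ⁅x, ψ⁆⁆` pairs `ψ` with an element of `U`. -/
theorem exists_mem_forall_lie_sub_eq_zero [FiniteDimensional ℝ M] {B : BilinForm ℝ M}
    (hB : B.IsSymm) (hpos : ∀ m ≠ 0, 0 < B m m) {U Z : Submodule ℝ M} (hUZ : U ≤ Z)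
    (hlie : ∀ (x : L), ∀ z ∈ Z, ⁅x, z⁆ ∈ U) {z : M} (hz : z ∈ Z) :
    ∃ u ∈ U, ∀ x y : L, LieAdjoint B x y → ⁅x, z - u⁆ = 0 := by
  have hdisj : Disjoint U (B.orthogonal U) := Submodule.disjoint_def.2 fun m hm hm' => by
    by_contra hne
    exact (hpos m hne).ne' (hm' m hm)
  obtain ⟨u, hu, ψ, hψ, rfl⟩ := Submodule.mem_sup.1
    (((BilinForm.isCompl_orthogonal_iff_disjoint hB.isRefl).2 hdisj).sup_eq_top ▸
      Submodule.mem_top : z ∈ _)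
  refine ⟨u, hu, fun x y hxy => ?_⟩
  rw [add_sub_cancel_left]
  have hψZ : ψ ∈ Z := (Submodule.add_mem_iff_right Z (hUZ hu)).1 hz
  by_contra hne
  refine (hpos _ hne).ne' ?_
  calc B ⁅x, ψ⁆ ⁅x, ψ⁆ = B ψ ⁅y, ⁅x, ψ⁆⁆ := hxy ψ ⁅x, ψ⁆
    _ = B ⁅y, ⁅x, ψ⁆⁆ ψ := hB.eq _ _
    _ = 0 := hψ _ (hlie y _ (hUZ (hlie x ψ hψZ)))

end InvariantComplement

section Cocycles

variable {L : Type*} [LieRing L] [LieAlgebra ℝ L]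

theorem d₁₂_mem_twoCocycle (f : oneCochain ℝ L L) : d₁₂ ℝ L L f ∈ twoCocycle ℝ L L :=
  (mem_twoCocycle_iff ℝ L L _).2 (LinearMap.congr_fun (d₂₃_comp_d₁₂ ℝ L L) f)

theorem subsingleton_adjointH2_iff : Subsingleton (AdjointH2 L) ↔
    ∀ φ ∈ twoCocycle ℝ L L, ∃ f, d₁₂ ℝ L L f = φ := by
  rw [Submodule.Quotient.subsingleton_iff, Submodule.eq_top_iff']
  simp [adjointCoboundaries, Submodule.submoduleOf]

theorem cohomologyClass_eq_zero_iff {φ : twoCochain ℝ L L} (hφ : φ ∈ twoCocycle ℝ L L) :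
    cohomologyClass φ hφ = 0 ↔ ∃ f, d₁₂ ℝ L L f = φ := by
  rw [cohomologyClass, Submodule.Quotient.mk_eq_zero]
  simp [adjointCoboundaries, Submodule.submoduleOf]

theorem lie_cochain_apply (φ : twoCochain ℝ L L) (x u v : L) :
    ⁅x, φ.1⁆ u v = ⁅x, φ u v⁆ - φ ⁅x, u⁆ v - φ u ⁅x, v⁆ := by
  simp only [LieHom.lie_apply, LinearMap.sub_apply, twoCochain_val_apply]
  abel

/-- Cartan's formula. -/
theorem d₁₂_contraction {φ : twoCochain ℝ L L} (hφ : φ ∈ twoCocycle ℝ L L) (x : L) :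
    (d₁₂ ℝ L L (φ x)).1 = ⁅x, φ.1⁆ := by
  ext u v
  have h := LinearMap.congr_fun (LinearMap.congr_fun (LinearMap.congr_fun
    ((mem_twoCocycle_iff ℝ L L φ).1 hφ) x) u) v
  simp only [d₂₃_apply, LinearMap.zero_apply] at h
  rw [lie_cochain_apply, twoCochain_val_apply, d₁₂_apply_apply, ← twoCochain_skew φ ⁅x, v⁆ u,
    ← twoCochain_skew φ ⁅u, v⁆ x, ← sub_eq_zero, ← neg_eq_zero, ← h]
  abel

/-- A 2-cochain is invariant under `x` if its Lie derivative along `x` vanishes. -/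
def IsLieInvariant (φ : twoCochain ℝ L L) (x : L) : Prop := ⁅x, φ.1⁆ = 0

theorem IsLieInvariant.lie_apply {φ : twoCochain ℝ L L} {x : L} (h : IsLieInvariant φ x) (u v : L) :
    ⁅x, φ u v⁆ = φ ⁅x, u⁆ v + φ u ⁅x, v⁆ := by
  have := lie_cochain_apply φ x u v
  rw [h, LinearMap.zero_apply, LinearMap.zero_apply] at this
  rw [← sub_eq_zero, this]
  abel

theorem exists_invariant_add_d₁₂ {ι : Type*} [Fintype ι] (b : Module.Basis ι ℝ L) {w : ι → ℝ}
    (hw : ∀ i, 0 < w i) {φ : twoCochain ℝ L L} (hφ : φ ∈ twoCocycle ℝ L L) :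
    ∃ ψ ∈ twoCocycle ℝ L L, ∃ f, φ = ψ + d₁₂ ℝ L L f ∧
      ∀ x y, LieAdjoint (diagForm b w) x y → IsLieInvariant ψ x := by
  have := b.finiteDimensional_of_finite
  let B := homForm b w (homForm b w (diagForm b w))
  have hsymm : B.IsSymm := homForm_isSymm _ _ (homForm_isSymm _ _ (diagForm_isSymm _ _))
  have hpos (c) (hc : c ≠ 0) : 0 < B c c := homForm_self_pos hw
    (fun _ h => homForm_self_pos hw (fun _ h => diagForm_self_pos hw h) h) hc
  obtain ⟨_, ⟨_, ⟨f, rfl⟩, rfl⟩, hf⟩ := exists_mem_forall_lie_sub_eq_zero (L := L) hsymm hpos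
    (U := (LinearMap.range (d₁₂ ℝ L L)).map (twoCochain ℝ L L).subtype)
    (Z := (twoCocycle ℝ L L).map (twoCochain ℝ L L).subtype)
    (Submodule.map_mono (LinearMap.range_le_iff_comap.2 (by ext f; simp [d₁₂_mem_twoCocycle])))
    (by
      rintro x _ ⟨φ, hφ, rfl⟩
      exact ⟨_, ⟨φ x, rfl⟩, d₁₂_contraction hφ x⟩)
    ⟨φ, hφ, rfl⟩
  exact ⟨φ - d₁₂ ℝ L L f, sub_mem hφ (d₁₂_mem_twoCocycle f), f, (sub_add_cancel _ _).symm,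
    fun x y hxy => hf x y (hxy.homForm hw (hxy.homForm hw hxy))⟩

end Cocycles

section LeviProjection

variable {L : Type*} [LieRing L] [LieAlgebra ℝ L]

/-- A linear projection of `L` onto a perfect subalgebra that commutes with the adjoint action of
that subalgebra; the model is the projection onto a Levi factor along an invariant complement. -/
structure IsPerfectProjection (π : L →ₗ[ℝ] L) : Prop where
  idem : ∀ x, π (π x) = π x
  map_lie : ∀ x y, π ⁅π x, y⁆ = ⁅π x, π y⁆
  mem_span_lie : ∀ x, π x ∈ Submodule.span ℝ {z | ∃ u v, ⁅π u, π v⁆ = z}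

variable {π T : L →ₗ[ℝ] L} {ψ : twoCochain ℝ L L}

/-- By Cartan's formula `ψ y` is a derivation, and its commutator with `ad x` is the inner
derivation of `ψ x y`. -/
theorem IsLieInvariant.apply_lie {x y : L} (hx : IsLieInvariant ψ x) (hy : IsLieInvariant ψ y)
    (hψ : ψ ∈ twoCocycle ℝ L L) : ψ ⁅x, y⁆ = LieAlgebra.ad ℝ L (ψ x y) := by
  have derivation (u v : L) : ψ y ⁅u, v⁆ = ⁅u, ψ y v⁆ - ⁅v, ψ y u⁆ := by
    have h := LinearMap.congr_fun₂ ((d₁₂_contraction hψ y).trans hy) u v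
    exact (sub_eq_zero.1 h).symm
  ext v
  calc ψ ⁅x, y⁆ v = ⁅x, ψ y v⁆ - ψ y ⁅x, v⁆ := eq_sub_of_add_eq (hx.lie_apply y v).symm
    _ = -⁅v, ψ x y⁆ := by rw [derivation, sub_sub_cancel, ← twoCochain_skew ψ x y, lie_neg]
    _ = ⁅ψ x y, v⁆ := lie_skew _ _

theorem IsPerfectProjection.exists_apply_eq_ad (hπ : IsPerfectProjection π)
    (had : Function.Injective (LieAlgebra.ad ℝ L)) (hψ : ψ ∈ twoCocycle ℝ L L)
    (hinv : ∀ x, IsLieInvariant ψ (π x)) :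
    ∃ T : L →ₗ[ℝ] L, ∀ x, ψ (π x) = LieAlgebra.ad ℝ L (T (π x)) := by
  let ad : L →ₗ[ℝ] Module.End ℝ L := LieAlgebra.ad ℝ L
  obtain ⟨P, hP⟩ := ad.exists_leftInverse_of_injective (LinearMap.ker_eq_bot.2 had)
  have inner (x : L) : π x ∈ (LinearMap.range ad).comap ψ.1 := by
    refine Submodule.span_le.2 ?_ (hπ.mem_span_lie x)
    rintro _ ⟨u, v, rfl⟩
    exact ⟨ψ (π u) (π v), ((hinv u).apply_lie (hinv v) hψ).symm⟩
  refine ⟨P ∘ₗ ψ.1, fun x => ?_⟩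
  obtain ⟨t, ht⟩ := inner x
  have hPt : P (ψ.1 (π x)) = t := by rw [← ht]; exact LinearMap.congr_fun hP t
  rw [LinearMap.comp_apply, hPt]
  exact ht.symm

theorem IsLieInvariant.map_lie_of_apply_eq_ad {y : L} (hy : IsLieInvariant ψ y)
    (had : Function.Injective (LieAlgebra.ad ℝ L))
    (hT : ∀ x, ψ (π x) = LieAlgebra.ad ℝ L (T (π x))) (hπ : ∀ x, π ⁅y, x⁆ = ⁅y, π x⁆) (x : L) :
    T (π ⁅y, x⁆) = ⁅y, T (π x)⁆ := by
  refine had (LinearMap.ext fun v => ?_)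
  have h := hy.lie_apply (π x) v
  rw [← hπ, hT, hT, LieAlgebra.ad_apply, LieAlgebra.ad_apply, LieAlgebra.ad_apply] at h
  rw [LieAlgebra.ad_apply, LieAlgebra.ad_apply, lie_lie, h, add_sub_cancel_right]

theorem d₁₂_isLieInvariant {f : oneCochain ℝ L L} {y : L} (hf : ∀ x, f ⁅y, x⁆ = ⁅y, f x⁆) :
    IsLieInvariant (d₁₂ ℝ L L f) y := by
  refine LinearMap.ext₂ fun u v => ?_
  rw [lie_cochain_apply]
  simp only [d₁₂_apply_apply, hf, lie_sub, lie_lie, LinearMap.zero_apply, map_sub]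
  abel

/-- Invariance under a perfect subalgebra makes the contractions with its elements inner
derivations; subtracting the coboundary of the resulting map to `L` kills them. -/
theorem IsPerfectProjection.exists_relative_add_d₁₂ (hπ : IsPerfectProjection π)
    (had : Function.Injective (LieAlgebra.ad ℝ L)) (hψ : ψ ∈ twoCocycle ℝ L L)
    (hinv : ∀ x, IsLieInvariant ψ (π x)) :
    ∃ χ ∈ twoCocycle ℝ L L, ∃ f, ψ = χ + d₁₂ ℝ L L f ∧ (∀ x, χ (π x) = 0) ∧
      ∀ y, (∀ x, π ⁅y, x⁆ = ⁅y, π x⁆) → IsLieInvariant ψ y → IsLieInvariant χ y := by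
  obtain ⟨T, hT⟩ := hπ.exists_apply_eq_ad had hψ hinv
  have equivariant {y : L} (hy : IsLieInvariant ψ y) (hyπ : ∀ x, π ⁅y, x⁆ = ⁅y, π x⁆) (x : L) :
      (T ∘ₗ π) ⁅y, x⁆ = ⁅y, (T ∘ₗ π) x⁆ := hy.map_lie_of_apply_eq_ad had hT hyπ x
  refine ⟨ψ - d₁₂ ℝ L L (T ∘ₗ π), sub_mem hψ (d₁₂_mem_twoCocycle _), T ∘ₗ π,
    (sub_add_cancel _ _).symm, fun x => LinearMap.ext fun v => ?_, fun y hyπ hy => ?_⟩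
  · change ψ (π x) v - d₁₂ ℝ L L (T ∘ₗ π) (π x) v = 0
    rw [d₁₂_apply_apply, equivariant (hinv x) (hπ.map_lie x), hT, LieAlgebra.ad_apply,
      LinearMap.comp_apply, LinearMap.comp_apply, hπ.idem, ← lie_skew v]
    abel
  · change ⁅y, ψ.1 - (d₁₂ ℝ L L (T ∘ₗ π)).1⁆ = 0
    rw [lie_sub, hy, d₁₂_isLieInvariant (equivariant hy hyπ), sub_zero]

end LeviProjection

section RelativeCocycles

variable {L ι : Type*} [LieRing L] [LieAlgebra ℝ L] [Fintype ι] {π : L →ₗ[ℝ] L}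
  {φ : twoCochain ℝ L L}

theorem IsPerfectProjection.exists_relative_invariant_add_d₁₂ (hπ : IsPerfectProjection π)
    (had : Function.Injective (LieAlgebra.ad ℝ L)) (b : Module.Basis ι ℝ L) {w : ι → ℝ}
    (hw : ∀ i, 0 < w i) (hadj : ∀ x, ∃ y, LieAdjoint (diagForm b w) (π x) y)
    (hφ : φ ∈ twoCocycle ℝ L L) :
    ∃ χ ∈ twoCocycle ℝ L L, ∃ f, φ = χ + d₁₂ ℝ L L f ∧ (∀ x, χ (π x) = 0) ∧
      ∀ x y, LieAdjoint (diagForm b w) x y → (∀ z, π ⁅x, z⁆ = ⁅x, π z⁆) → IsLieInvariant χ x := by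
  obtain ⟨ψ, hψ, f, rfl, hinv⟩ := exists_invariant_add_d₁₂ b hw hφ
  obtain ⟨χ, hχ, g, rfl, hχπ, hχinv⟩ := hπ.exists_relative_add_d₁₂ had hψ fun x =>
    (hadj x).elim (hinv _)
  exact ⟨χ, hχ, g + f, by rw [map_add, add_assoc], hχπ, fun x y hxy hx => hχinv x hx (hinv x y hxy)⟩

end RelativeCocycles

/-! ### Openness of orbits -/

section StrictDerivative

open Filter Topology

variable {𝕜 E F G : Type*} [NontriviallyNormedField 𝕜] [CompleteSpace 𝕜]
  [NormedAddCommGroup E] [NormedSpace 𝕜 E] [CompleteSpace E]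
  [NormedAddCommGroup F] [NormedSpace 𝕜 F] [FiniteDimensional 𝕜 F]
  [NormedAddCommGroup G] [NormedSpace 𝕜 G]

theorem eventually_eq_zero_of_map_add_eq {q : F → G} {q' : F →L[𝕜] G} {y : F}
    (hq : HasStrictFDerivAt q q' y) {W : Submodule 𝕜 F} (hW : Disjoint q'.ker W) :
    ∀ᶠ p : F × W in 𝓝 (y, 0), q (p.1 + p.2) = q p.1 → p.2 = 0 := by
  obtain ⟨K, hK, hanti⟩ := (q'.toLinearMap ∘ₗ W.subtype).exists_antilipschitzWith
    (LinearMap.ker_eq_bot'.2 fun w hw => Subtype.ext (Submodule.disjoint_def.1 hW _ hw w.2))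
  have hKpos : (0 : ℝ) < K := hK
  have hlim : Tendsto (fun p : F × W => (p.1 + (p.2 : F), p.1)) (𝓝 (y, 0)) (𝓝 (y, y)) :=
    Continuous.tendsto' (by fun_prop) _ _ (by simp)
  filter_upwards [hlim.eventually (hq.isLittleO.def (half_pos (inv_pos.2 hKpos)))] with p hp h
  simp only [h, add_sub_cancel_left, sub_self, zero_sub, norm_neg] at hp
  have hlower : ‖p.2‖ ≤ K * ‖q' p.2‖ := by simpa using hanti.le_mul_norm_sub p.2 0
  rw [← norm_le_zero_iff]
  have hp' : K * ‖q' p.2‖ ≤ K * ((K : ℝ)⁻¹ / 2 * ‖p.2‖) := mul_le_mul_of_nonneg_left hp hKpos.le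
  rw [← mul_assoc, mul_div_assoc', mul_inv_cancel₀ hKpos.ne'] at hp'
  linarith

/-- Translating `f` by a complement `W` of the kernel of `q'` gives a submersion, and `q` separates
the translates. -/
theorem nhdsWithin_preimage_zero_le_map {f : E → F} {q : F → G} {f' : E →L[𝕜] F}
    {q' : F →L[𝕜] G} {a : E} (hf : HasStrictFDerivAt f f' a) (hq : HasStrictFDerivAt q q' (f a))
    (hqf : ∀ᶠ x in 𝓝 a, q (f x) = 0) (hexact : q'.ker ≤ f'.range) :
    𝓝[q ⁻¹' {0}] (f a) ≤ map f (𝓝 a) := by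
  have := FiniteDimensional.complete 𝕜 F
  obtain ⟨W, hW⟩ := Submodule.exists_isCompl q'.ker
  have := FiniteDimensional.complete 𝕜 W
  let g : E × W → F := fun p => f p.1 + p.2
  have hg : HasStrictFDerivAt g (f'.coprod W.subtypeL) (a, 0) := by
    exact (hf.comp (a, (0 : W)) hasStrictFDerivAt_fst).add
      (W.subtypeL.hasStrictFDerivAt.comp (a, (0 : W)) hasStrictFDerivAt_snd)
  have hsurj : (f'.coprod W.subtypeL).range = ⊤ := by
    rw [ContinuousLinearMap.range_coprod, Submodule.toLinearMap_subtypeL, Submodule.range_subtype]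
    exact top_unique (hW.sup_eq_top ▸ sup_le_sup_right hexact W)
  have hmap : map g (𝓝 (a, 0)) = 𝓝 (f a) := by
    simpa [g] using hg.map_nhds_eq_of_surj hsurj
  have hfst : Tendsto (fun p : E × W => p.1) (𝓝 (a, 0)) (𝓝 a) := continuous_fst.tendsto _
  have hsep : ∀ᶠ p : E × W in 𝓝 (a, 0), q (g p) = q (f p.1) → p.2 = 0 := by
    have : Tendsto (fun p : E × W => (f p.1, p.2)) (𝓝 (a, 0)) (𝓝 (f a, 0)) :=
      (hf.continuousAt.tendsto.comp hfst).prodMk_nhds (continuous_snd.tendsto _)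
    exact this.eventually (eventually_eq_zero_of_map_add_eq hq hW.disjoint)
  intro s hs
  rw [mem_nhdsWithin_iff_eventually, ← hmap, eventually_map]
  filter_upwards [hsep, hfst.eventually hqf, hfst.eventually hs] with p hp hfp hps hgp
  have hp2 : p.2 = 0 := hp (hgp.trans hfp.symm)
  simpa [g, hp2] using hps

end StrictDerivative

section Tensors

variable {n : ℕ}

theorem tensorMap_single (C : Fin n → Fin n → Fin n → ℝ) (i j : Fin n) :
    tensorMap C (Pi.single i 1) (Pi.single j 1) = C i j := by
  ext k
  simp [tensorMap_apply, Pi.single_apply]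

theorem bilin_ext {V : Type*} [AddCommGroup V] [Module ℝ V]
    {B B' : (Fin n → ℝ) →ₗ[ℝ] (Fin n → ℝ) →ₗ[ℝ] V}
    (h : ∀ i j, B (Pi.single i 1) (Pi.single j 1) = B' (Pi.single i 1) (Pi.single j 1)) :
    B = B' :=
  (Pi.basisFun ℝ (Fin n)).ext fun i => (Pi.basisFun ℝ (Fin n)).ext fun j => by simpa using h i j

theorem tensorMap_bilin (B : (Fin n → ℝ) →ₗ[ℝ] (Fin n → ℝ) →ₗ[ℝ] (Fin n → ℝ)) :
    tensorMap (fun i j => B (Pi.single i 1) (Pi.single j 1)) = B :=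
  bilin_ext fun i j => tensorMap_single _ i j

theorem tensorMap_add (C D : Fin n → Fin n → Fin n → ℝ) :
    tensorMap (C + D) = tensorMap C + tensorMap D :=
  bilin_ext fun i j => by simp [tensorMap_single]

theorem tensorMap_smul (r : ℝ) (C : Fin n → Fin n → Fin n → ℝ) :
    tensorMap (r • C) = r • tensorMap C :=
  bilin_ext fun i j => by simp [tensorMap_single]

end Tensors

section LawEquations

variable {n : ℕ}

/-- The polarized Jacobi expression: the Jacobi identity for a tensor `C` is
`jacobiForm C C = 0`. -/
def jacobiForm : (Fin n → Fin n → Fin n → ℝ) →ₗ[ℝ] (Fin n → Fin n → Fin n → ℝ) →ₗ[ℝ]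
    (Fin n → Fin n → Fin n → Fin n → ℝ) :=
  LinearMap.mk₂ ℝ (fun C D i j k => tensorMap C (Pi.single i 1) (D j k) +
      tensorMap C (Pi.single j 1) (D k i) + tensorMap C (Pi.single k 1) (D i j))
    (fun C C' D => by
      funext i j k
      simp only [Pi.add_apply, tensorMap_add, LinearMap.add_apply]
      abel)
    (fun r C D => by
      funext i j k
      simp only [Pi.smul_apply, tensorMap_smul, LinearMap.smul_apply, smul_add])
    (fun C D D' => by
      funext i j k
      simp only [Pi.add_apply, map_add]
      abel)
    (fun r C D => by
      funext i j k
      simp only [Pi.smul_apply, map_smul, smul_add])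

/-- The symmetric part of a tensor; it vanishes exactly for the tensors of alternating maps. -/
def symmPart : (Fin n → Fin n → Fin n → ℝ) →ₗ[ℝ] (Fin n → Fin n → Fin n → ℝ) where
  toFun C i j := C i j + C j i
  map_add' C D := by
    funext i j
    simp only [Pi.add_apply]
    abel
  map_smul' r C := by
    funext i j
    simp only [Pi.smul_apply, RingHom.id_apply, smul_add]

/-- The variety of Lie algebra laws is the zero set of this quadratic map. -/
def lawEquations (C : Fin n → Fin n → Fin n → ℝ) :
    (Fin n → Fin n → Fin n → ℝ) × (Fin n → Fin n → Fin n → Fin n → ℝ) :=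
  (symmPart C, jacobiForm C C)

theorem lawEquations_eq_zero (μ : LieLaw n) : lawEquations μ.1 = 0 := by
  refine Prod.ext (funext fun i => funext fun j => ?_)
    (funext fun i => funext fun j => funext fun k => ?_)
  · have h : μ.1 i j = -μ.1 j i := by
      simpa only [LieLaw.bracket, tensorMap_single] using
        μ.bracket_skew (Pi.single i 1) (Pi.single j 1)
    exact add_eq_zero_iff_eq_neg.2 h
  · have h := μ.2.2 (Pi.single i 1) (Pi.single j 1) (Pi.single k 1)
    simp only [tensorMap_single] at h
    exact h

theorem exists_hasStrictFDerivAt_lawEquations (C : Fin n → Fin n → Fin n → ℝ) :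
    ∃ q' : (Fin n → Fin n → Fin n → ℝ) →L[ℝ] _, HasStrictFDerivAt lawEquations q' C ∧
      ∀ D, q' D = (symmPart D, jacobiForm C D + jacobiForm D C) :=
  let J := jacobiForm.toContinuousBilinearMap (𝕜 := ℝ)
  ⟨_, (LinearMap.toContinuousLinearMap symmPart).hasStrictFDerivAt.prodMk
    (J.hasStrictFDerivAt_of_bilinear (hasStrictFDerivAt_id C) (hasStrictFDerivAt_id C)),
    fun _ => rfl⟩

end LawEquations

section Transport

open Filter Topology

variable {n : ℕ}

theorem tensorMap_conj (C : Fin n → Fin n → Fin n → ℝ) (g : (Fin n → ℝ) ≃ₗ[ℝ] (Fin n → ℝ))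
    (x y : Fin n → ℝ) :
    tensorMap (fun i j => g (tensorMap C (g.symm (Pi.single i 1)) (g.symm (Pi.single j 1)))) x y =
      g (tensorMap C (g.symm x) (g.symm y)) :=
  LinearMap.congr_fun₂ (tensorMap_bilin <|
    ((tensorMap C).compl₁₂ g.symm.toLinearMap g.symm.toLinearMap).compr₂ g.toLinearMap) x y

/-- The law obtained from `μ` by the change of coordinates `g`. -/
def LieLaw.transport (μ : LieLaw n) (g : (Fin n → ℝ) ≃ₗ[ℝ] (Fin n → ℝ)) : LieLaw n :=
  ⟨fun i j => g (μ.bracket (g.symm (Pi.single i 1)) (g.symm (Pi.single j 1))),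
    fun x => by rw [bracket, tensorMap_conj, μ.2.1, map_zero],
    fun x y z => by
      simp only [bracket, tensorMap_conj, LinearEquiv.symm_apply_apply, ← map_add, μ.2.2, map_zero]⟩

theorem LieLaw.transport_bracket (μ : LieLaw n) (g : (Fin n → ℝ) ≃ₗ[ℝ] (Fin n → ℝ))
    (x y : Fin n → ℝ) : (μ.transport g).bracket x y = g (μ.bracket (g.symm x) (g.symm y)) :=
  tensorMap_conj μ.1 g x y

theorem LieLaw.bracket_injective : Function.Injective (LieLaw.bracket (n := n)) := fun μ ν h =>
  Subtype.ext <| funext fun i => funext fun j => by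
    rw [← tensorMap_single μ.1, ← tensorMap_single ν.1]
    exact LinearMap.congr_fun₂ h _ _

theorem LieLaw.mem_orbit_iff {μ ν : LieLaw n} : ν ∈ μ.orbit ↔ ∃ g, μ.transport g = ν :=
  exists_congr fun g => ⟨fun h => LieLaw.bracket_injective <| LinearMap.ext₂ fun x y =>
    (μ.transport_bracket g x y).trans (h x y).symm, fun h => h ▸ μ.transport_bracket g⟩

theorem LieLaw.transport_trans (μ : LieLaw n) (g h : (Fin n → ℝ) ≃ₗ[ℝ] (Fin n → ℝ)) :
    (μ.transport g).transport h = μ.transport (g.trans h) :=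
  LieLaw.bracket_injective <| LinearMap.ext₂ fun x y => by
    simp [LieLaw.transport_bracket]

theorem LieLaw.transport_symm_transport (μ : LieLaw n) (g : (Fin n → ℝ) ≃ₗ[ℝ] (Fin n → ℝ)) :
    (μ.transport g).transport g.symm = μ :=
  LieLaw.bracket_injective <| LinearMap.ext₂ fun x y => by
    simp [LieLaw.transport_bracket]

theorem LieLaw.continuous_transport (g : (Fin n → ℝ) ≃ₗ[ℝ] (Fin n → ℝ)) :
    Continuous fun μ : LieLaw n => μ.transport g := by
  have apply (x y : Fin n → ℝ) :
      Continuous fun C : Fin n → Fin n → Fin n → ℝ => tensorMap C x y := by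
    refine continuous_pi fun k => ?_
    simp only [tensorMap_apply]
    fun_prop
  exact Continuous.subtype_mk (continuous_pi fun i => continuous_pi fun j =>
    g.toLinearMap.continuous_of_finiteDimensional.comp
      ((apply _ _).comp continuous_subtype_val)) _

end Transport

section Deformations

open Filter Topology

variable {n : ℕ}

theorem exists_twoCocycle_apply_eq_tensorMap (μ : LieLaw n) {D : Fin n → Fin n → Fin n → ℝ}
    (hsymm : symmPart D = 0) (hjacobi : jacobiForm μ.1 D + jacobiForm D μ.1 = 0) :
    ∃ φ ∈ twoCocycle ℝ μ.Alg μ.Alg, ∀ x y, φ x y = tensorMap D x y := by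
  have skew (x y : Fin n → ℝ) : tensorMap D x y = -tensorMap D y x := by
    have h : tensorMap D = -(tensorMap D).flip := bilin_ext fun i j => by
      rw [LinearMap.neg_apply, LinearMap.neg_apply, LinearMap.flip_apply, tensorMap_single,
        tensorMap_single]
      exact eq_neg_of_add_eq_zero_left (congrFun₂ hsymm i j)
    exact LinearMap.congr_fun₂ h x y
  have alt (x : Fin n → ℝ) : tensorMap D x x = 0 := self_eq_neg.1 (skew x x)
  let φ : twoCochain ℝ μ.Alg μ.Alg :=
    ⟨(tensorMap D : (Fin n → ℝ) →ₗ[ℝ] (Fin n → ℝ) →ₗ[ℝ] (Fin n → ℝ)), alt⟩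
  let b : Module.Basis (Fin n) ℝ μ.Alg := Pi.basisFun ℝ (Fin n)
  have hb (i : Fin n) : b i = (Pi.single i 1 : Fin n → ℝ) := Pi.basisFun_apply ℝ (Fin n) i
  have hφb (i j : Fin n) : φ (b i) (b j) = D i j := by
    rw [hb, hb]
    exact tensorMap_single D i j
  have hlieb (i j : Fin n) : ⁅b i, b j⁆ = (μ.1 i j : μ.Alg) := by
    rw [hb, hb]
    exact tensorMap_single μ.1 i j
  refine ⟨φ, (mem_twoCocycle_iff ℝ μ.Alg μ.Alg φ).2 ?_, fun x y => rfl⟩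
  refine b.ext fun i => b.ext fun j => b.ext fun k => ?_
  have h : ⁅b i, φ (b j) (b k)⁆ + ⁅b j, φ (b k) (b i)⁆ + ⁅b k, φ (b i) (b j)⁆ +
      (φ (b i) ⁅b j, b k⁆ + φ (b j) ⁅b k, b i⁆ + φ (b k) ⁅b i, b j⁆) = 0 := by
    rw [hφb, hφb, hφb, hlieb, hlieb, hlieb, hb, hb, hb]
    exact congrFun (congrFun₂ hjacobi i j) k
  rw [← twoCochain_skew φ (b i) (b k), ← lie_skew (b k) (b i),
    ← twoCochain_skew φ ⁅b j, b k⁆ (b i), ← twoCochain_skew φ ⁅b i, b j⁆ (b k)] at h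
  rw [d₂₃_apply, LinearMap.zero_apply, LinearMap.zero_apply, LinearMap.zero_apply, ← h,
    ← twoCochain_skew φ (b j) ⁅b i, b k⁆]
  simp only [lie_neg, map_neg]
  abel

/-- The structure tensor of the law `(x, y) ↦ A⁻¹ (μ (A x, A y))`, for an invertible
endomorphism `A`. -/
def pullbackTensor (μ : LieLaw n) (A : (Fin n → ℝ) →L[ℝ] (Fin n → ℝ)) (i j : Fin n) :
    Fin n → ℝ :=
  Ring.inverse A (μ.bracket (A (Pi.single i 1)) (A (Pi.single j 1)))

theorem pullbackTensor_one (μ : LieLaw n) : pullbackTensor μ 1 = μ.1 := by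
  funext i j
  simp [pullbackTensor, LieLaw.bracket, tensorMap_single]

theorem pullbackTensor_unit (μ : LieLaw n) (u : ((Fin n → ℝ) →L[ℝ] (Fin n → ℝ))ˣ) :
    pullbackTensor μ u =
      (μ.transport (ContinuousLinearEquiv.ofUnit u).symm.toLinearEquiv).1 := by
  funext i j
  rw [pullbackTensor, Ring.inverse_unit]
  rfl

theorem exists_hasStrictFDerivAt_pullbackTensor (μ : LieLaw n) :
    ∃ f' : ((Fin n → ℝ) →L[ℝ] (Fin n → ℝ)) →L[ℝ] (Fin n → Fin n → Fin n → ℝ),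
      HasStrictFDerivAt (pullbackTensor μ) f' 1 ∧ ∀ X i j, f' X i j =
        μ.bracket (Pi.single i 1) (X (Pi.single j 1)) +
          μ.bracket (X (Pi.single i 1)) (Pi.single j 1) -
          X (μ.bracket (Pi.single i 1) (Pi.single j 1)) := by
  let β := LinearMap.toContinuousBilinearMap (𝕜 := ℝ) μ.bracket
  have eval (i : Fin n) := (ContinuousLinearMap.apply ℝ (Fin n → ℝ)
    (Pi.single i 1 : Fin n → ℝ)).hasStrictFDerivAt (x := 1)
  refine ⟨_, hasStrictFDerivAt_pi.2 fun i => hasStrictFDerivAt_pi.2 fun j =>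
    (hasStrictFDerivAt_ringInverse (𝕜 := ℝ) (1 : ((Fin n → ℝ) →L[ℝ] (Fin n → ℝ))ˣ)).clm_apply
      (β.hasStrictFDerivAt_of_bilinear (eval i) (eval j)), fun X i j => ?_⟩
  simp [β, sub_eq_add_neg]

theorem LieLaw.orbit_mem_nhds (μ : LieLaw n)
    (h : ∀ φ ∈ twoCocycle ℝ μ.Alg μ.Alg, ∃ f, d₁₂ ℝ μ.Alg μ.Alg f = φ) : μ.orbit ∈ 𝓝 μ := by
  obtain ⟨f', hf, hf'⟩ := exists_hasStrictFDerivAt_pullbackTensor μ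
  obtain ⟨q', hq, hq'⟩ := exists_hasStrictFDerivAt_lawEquations μ.1
  have hexact : q'.ker ≤ f'.range := fun D hD => by
    obtain ⟨hsymm, hjacobi⟩ := Prod.mk_eq_zero.1 ((hq' D).symm.trans hD)
    obtain ⟨φ, hφ, hφD⟩ := exists_twoCocycle_apply_eq_tensorMap μ hsymm hjacobi
    obtain ⟨f, rfl⟩ := h φ hφ
    let X : (Fin n → ℝ) →L[ℝ] (Fin n → ℝ) :=
      LinearMap.toContinuousLinearMap (f : (Fin n → ℝ) →ₗ[ℝ] (Fin n → ℝ))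
    refine ⟨X, funext fun i => funext fun j => (hf' X i j).trans ?_⟩
    rw [← tensorMap_single D i j, μ.bracket_skew (X _), ← sub_eq_add_neg]
    exact hφD (Pi.single i 1 : Fin n → ℝ) (Pi.single j 1 : Fin n → ℝ)
  have units : ∀ᶠ A in 𝓝 1, ∃ g, (μ.transport g).1 = pullbackTensor μ A :=
    mem_of_superset (Units.isOpen.mem_nhds isUnit_one) fun A hA => by
      obtain ⟨u, rfl⟩ := hA
      exact ⟨_, (pullbackTensor_unit μ u).symm⟩
  have hle : 𝓝[lawEquations ⁻¹' {0}] μ.1 ≤ map (pullbackTensor μ) (𝓝 1) := by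
    have hlaw : ∀ᶠ A in 𝓝 1, lawEquations (pullbackTensor μ A) = 0 :=
      units.mono fun A ⟨g, hg⟩ => hg ▸ lawEquations_eq_zero _
    rw [← pullbackTensor_one μ] at hq ⊢
    exact nhdsWithin_preimage_zero_le_map hf hq hlaw hexact
  have law : Tendsto Subtype.val (𝓝 μ) (𝓝[lawEquations ⁻¹' {0}] μ.1) :=
    tendsto_nhdsWithin_iff.2 ⟨continuous_subtype_val.tendsto _, .of_forall lawEquations_eq_zero⟩
  have near : ∀ᶠ C in 𝓝[lawEquations ⁻¹' {0}] μ.1, ∃ g, (μ.transport g).1 = C :=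
    hle (show ∀ᶠ C in map (pullbackTensor μ) (𝓝 1), _ from units)
  filter_upwards [law.eventually near] with ν ⟨g, hg⟩
  exact LieLaw.mem_orbit_iff.2 ⟨g, Subtype.ext hg⟩

theorem LieLaw.isStable_of_subsingleton_adjointH2 (μ : LieLaw n)
    (h : Subsingleton (AdjointH2 μ.Alg)) : μ.IsStable := by
  refine isOpen_iff_mem_nhds.2 fun ν hν => ?_
  obtain ⟨g, rfl⟩ := LieLaw.mem_orbit_iff.1 hν
  have near : ∀ᶠ τ in 𝓝 (μ.transport g), τ.transport g.symm ∈ μ.orbit :=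
    (LieLaw.continuous_transport g.symm).tendsto' _ _ (μ.transport_symm_transport g)
      (μ.orbit_mem_nhds (subsingleton_adjointH2_iff.1 h))
  filter_upwards [near] with τ hτ
  obtain ⟨k, hk⟩ := LieLaw.mem_orbit_iff.1 hτ
  refine LieLaw.mem_orbit_iff.2 ⟨k.trans g, ?_⟩
  rw [← LieLaw.transport_trans, hk]
  exact τ.transport_symm_transport g.symm

end Deformations

/-! ### Laws on `ℝ⁷` -/

section SevenDimensional

theorem cochain_apply_eq_sum {L : Type*} [LieRing L] [LieAlgebra ℝ L]
    (b : Module.Basis (Fin 7) ℝ L) {χ : twoCochain ℝ L L} (h₀ : χ (b 0) = 0) (h₁ : χ (b 1) = 0)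
    (h₂ : χ (b 2) = 0) (x y : L) : χ x y =
      (b.repr x 3 * b.repr y 4 - b.repr x 4 * b.repr y 3) • χ (b 3) (b 4) +
      (b.repr x 3 * b.repr y 5 - b.repr x 5 * b.repr y 3) • χ (b 3) (b 5) +
      (b.repr x 3 * b.repr y 6 - b.repr x 6 * b.repr y 3) • χ (b 3) (b 6) +
      (b.repr x 4 * b.repr y 5 - b.repr x 5 * b.repr y 4) • χ (b 4) (b 5) +
      (b.repr x 4 * b.repr y 6 - b.repr x 6 * b.repr y 4) • χ (b 4) (b 6) +
      (b.repr x 5 * b.repr y 6 - b.repr x 6 * b.repr y 5) • χ (b 5) (b 6) := by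
  have right {u : L} (hu : χ u = 0) (v : L) : χ v u = 0 := by
    rw [← twoCochain_skew, hu, LinearMap.zero_apply, neg_zero]
  have self (u : L) : χ u u = 0 := χ.2 u
  conv_lhs => rw [← b.sum_repr x, ← b.sum_repr y]
  simp only [Fin.sum_univ_seven, map_add, LinearMap.add_apply, map_smul, LinearMap.smul_apply,
    h₀, h₁, h₂, right h₀, right h₁, right h₂, self, LinearMap.zero_apply,
    ← twoCochain_skew χ (b 3) (b 4), ← twoCochain_skew χ (b 3) (b 5),
    ← twoCochain_skew χ (b 3) (b 6), ← twoCochain_skew χ (b 4) (b 5),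
    ← twoCochain_skew χ (b 4) (b 6), ← twoCochain_skew χ (b 5) (b 6)]
  module

/-- The projection of `ℝ⁷` onto the span of `X₁, X₂, X₃`, the Levi factor in all the laws
considered here, along the span of `X₄, …, X₇`. -/
def leviProj : (Fin 7 → ℝ) →ₗ[ℝ] (Fin 7 → ℝ) where
  toFun x := ![x 0, x 1, x 2, 0, 0, 0, 0]
  map_add' x y := by simp
  map_smul' c x := by simp

theorem leviProj_apply (x : Fin 7 → ℝ) : leviProj x = ![x 0, x 1, x 2, 0, 0, 0, 0] := rfl

theorem leviProj_comm_of_diagonal {T : (Fin 7 → ℝ) →ₗ[ℝ] (Fin 7 → ℝ)} {m : Fin 7 → ℝ}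
    (hT : ∀ y k, T y k = m k * y k) (z : Fin 7 → ℝ) : leviProj (T z) = T (leviProj z) := by
  ext k
  rw [hT]
  fin_cases k <;> simp [leviProj_apply, hT]

/-- The span of `X₁, X₂, X₃` is a perfect subalgebra of the centreless Lie algebra `(ℝ⁷, μ)`, it
normalizes the span of `X₄, …, X₇`, and its adjoint action is closed under transposition with
respect to the inner product for which `X₁, …, X₇` are orthogonal with squares `w`. -/
structure LieLaw.IsLeviSplit (μ : LieLaw 7) (w : Fin 7 → ℝ) : Prop where
  pos : ∀ i, 0 < w i
  map_bracket : ∀ x y, leviProj (μ.bracket (leviProj x) y) = μ.bracket (leviProj x) (leviProj y)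
  perfect : ∀ x, ∃ u v u' v', leviProj x =
    μ.bracket (leviProj u) (leviProj v) + μ.bracket (leviProj u') (leviProj v')
  transpose : ∀ x, ∃ y, ∀ u v, ∑ i, w i * (μ.bracket (leviProj x) u i * v i) =
    ∑ i, w i * (u i * μ.bracket y v i)
  eq_zero_of_bracket : ∀ x, (∀ y, μ.bracket x y = 0) → x = 0

variable {μ : LieLaw 7} {w : Fin 7 → ℝ} {χ φ : twoCochain ℝ μ.Alg μ.Alg}

/-- A 2-cocycle that vanishes on `X₁, X₂, X₃` and is invariant under these elements and under all
elements acting diagonally in the basis `X₁, …, X₇`. -/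
structure IsReducedCocycle (χ : twoCochain ℝ μ.Alg μ.Alg) : Prop where
  mem_twoCocycle : χ ∈ twoCocycle ℝ μ.Alg μ.Alg
  apply_leviProj : ∀ x, χ (leviProj x) = 0
  invariant_leviProj : ∀ x : Fin 7 → ℝ, IsLieInvariant χ (leviProj x)
  invariant_of_diagonal : ∀ (x : μ.Alg) (m : Fin 7 → ℝ), (∀ y k, μ.bracket x y k = m k * y k) →
    IsLieInvariant χ x

theorem LieLaw.IsLeviSplit.isPerfectProjection (h : μ.IsLeviSplit w) :
    IsPerfectProjection (L := μ.Alg) leviProj where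
  idem _ := rfl
  map_lie := h.map_bracket
  mem_span_lie x := by
    obtain ⟨u, v, u', v', hx⟩ := h.perfect x
    exact hx ▸ add_mem (Submodule.subset_span ⟨u, v, rfl⟩) (Submodule.subset_span ⟨u', v', rfl⟩)

theorem LieLaw.IsLeviSplit.ad_injective (h : μ.IsLeviSplit w) :
    Function.Injective (LieAlgebra.ad ℝ μ.Alg) :=
  (injective_iff_map_eq_zero _).2 fun x hx =>
    h.eq_zero_of_bracket x fun y => LinearMap.congr_fun hx y

/-- The standard basis of `(ℝ⁷, μ)`. -/
def LieLaw.basis (μ : LieLaw 7) : Module.Basis (Fin 7) ℝ μ.Alg := Pi.basisFun ℝ (Fin 7)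

theorem lieAdjoint_basis_iff {x y : Fin 7 → ℝ} :
    LieAdjoint (L := μ.Alg) (diagForm μ.basis w) x y ↔
      ∀ u v, ∑ i, w i * (μ.bracket x u i * v i) = ∑ i, w i * (u i * μ.bracket y v i) :=
  forall₂_congr fun u v => by
    rw [diagForm_apply, diagForm_apply]
    rfl

theorem LieLaw.IsLeviSplit.exists_isReducedCocycle (h : μ.IsLeviSplit w)
    (hφ : φ ∈ twoCocycle ℝ μ.Alg μ.Alg) :
    ∃ χ, IsReducedCocycle χ ∧ ∃ f, φ = χ + d₁₂ ℝ μ.Alg μ.Alg f := by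
  have transpose (x : Fin 7 → ℝ) : ∃ y : Fin 7 → ℝ,
      LieAdjoint (L := μ.Alg) (diagForm μ.basis w) (leviProj x) y :=
    (h.transpose x).imp fun _ => lieAdjoint_basis_iff.2
  obtain ⟨χ, hχ, f, hf, hzero, hinv⟩ :=
    h.isPerfectProjection.exists_relative_invariant_add_d₁₂ h.ad_injective μ.basis h.pos
      transpose hφ
  refine ⟨χ, ⟨hχ, hzero, fun x => ?_, fun x m hx => hinv x x ?_ fun z => ?_⟩, f, hf⟩
  · obtain ⟨y, hy⟩ := transpose x
    exact hinv _ y hy (h.map_bracket x)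
  · exact lieAdjoint_basis_iff.2 fun u v => by simp only [hx, mul_assoc, mul_left_comm]
  · exact leviProj_comm_of_diagonal hx z

theorem LieLaw.IsLeviSplit.subsingleton_adjointH2 (h : μ.IsLeviSplit w)
    (hred : ∀ χ, IsReducedCocycle χ → ∃ f, d₁₂ ℝ μ.Alg μ.Alg f = χ) :
    Subsingleton (AdjointH2 μ.Alg) :=
  subsingleton_adjointH2_iff.2 fun φ hφ => by
    obtain ⟨χ, hχ, f, rfl⟩ := h.exists_isReducedCocycle hφ
    obtain ⟨g, rfl⟩ := hred χ hχ
    exact ⟨g + f, map_add _ g f⟩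

/-- A 2-cochain of `(ℝ⁷, μ)` as a bilinear map on `ℝ⁷`, so that its values have coordinates. -/
def cochainBilin :
    twoCochain ℝ μ.Alg μ.Alg →ₗ[ℝ] (Fin 7 → ℝ) →ₗ[ℝ] (Fin 7 → ℝ) →ₗ[ℝ] (Fin 7 → ℝ) :=
  (twoCochain ℝ μ.Alg μ.Alg).subtype

/-- The structure constants of a 2-cochain: `cochainCoeff χ i j k` is the `k`-th coordinate of
`χ (Pi.single i 1) (Pi.single j 1)`. Indices run from 0 to 6, so `X₁ = Pi.single 0 1`. -/
def cochainCoeff (χ : twoCochain ℝ μ.Alg μ.Alg) (i j k : Fin 7) : ℝ :=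
  cochainBilin χ (Pi.single i 1) (Pi.single j 1) k

theorem d₁₂_eq_iff (f : (Fin 7 → ℝ) →ₗ[ℝ] (Fin 7 → ℝ)) :
    d₁₂ ℝ μ.Alg μ.Alg f = φ ↔ ∀ x y k, cochainBilin φ x y k =
      μ.bracket x (f y) k - μ.bracket y (f x) k - f (μ.bracket x y) k :=
  ⟨fun h _ _ _ => h ▸ rfl,
    fun h => Subtype.ext <| LinearMap.ext₂ fun x y => funext fun k => (h x y k).symm⟩

theorem mem_twoCocycle_iff_apply : φ ∈ twoCocycle ℝ μ.Alg μ.Alg ↔ ∀ x y z k,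
    μ.bracket x (cochainBilin φ y z) k - μ.bracket y (cochainBilin φ x z) k +
      μ.bracket z (cochainBilin φ x y) k - cochainBilin φ (μ.bracket x y) z k +
      cochainBilin φ (μ.bracket x z) y k - cochainBilin φ (μ.bracket y z) x k = 0 := by
  rw [mem_twoCocycle_iff]
  refine ⟨fun h x y z k => ?_, fun h => ?_⟩
  · have h' (x y z : μ.Alg) : d₂₃ ℝ μ.Alg μ.Alg φ x y z = 0 := by
      rw [h]
      rfl
    simp only [d₂₃_apply] at h'
    exact congrFun (h' x y z) k
  · ext x y z
    rw [d₂₃_apply]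
    exact funext (h x y z)

namespace IsReducedCocycle

theorem apply_eq_sum (hχ : IsReducedCocycle χ) (x y : Fin 7 → ℝ) (k : Fin 7) :
    cochainBilin χ x y k =
      (x 3 * y 4 - x 4 * y 3) * cochainCoeff χ 3 4 k +
      (x 3 * y 5 - x 5 * y 3) * cochainCoeff χ 3 5 k +
      (x 3 * y 6 - x 6 * y 3) * cochainCoeff χ 3 6 k +
      (x 4 * y 5 - x 5 * y 4) * cochainCoeff χ 4 5 k +
      (x 4 * y 6 - x 6 * y 4) * cochainCoeff χ 4 6 k +
      (x 5 * y 6 - x 6 * y 5) * cochainCoeff χ 5 6 k := by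
  have single (i : Fin 7) : μ.basis i = (Pi.single i 1 : Fin 7 → ℝ) := Pi.basisFun_apply ℝ _ i
  have levi (i : Fin 7) (hi : leviProj (Pi.single i 1) = Pi.single i 1) : χ (μ.basis i) = 0 := by
    rw [single, ← hi]
    exact hχ.apply_leviProj _
  have fixed (i : Fin 7) (hi : i < 3) : leviProj (Pi.single i 1) = Pi.single i 1 := by
    ext k
    fin_cases i <;> fin_cases k <;> simp [leviProj_apply] at hi ⊢
  have h := cochain_apply_eq_sum μ.basis (levi 0 (fixed 0 (by decide)))
    (levi 1 (fixed 1 (by decide))) (levi 2 (fixed 2 (by decide))) x y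
  rw [single, single, single, single] at h
  exact congrFun h k

theorem bracket_apply_single (hχ : IsReducedCocycle χ) (l i j k : Fin 7) :
    μ.bracket (leviProj (Pi.single l 1)) (cochainBilin χ (Pi.single i 1) (Pi.single j 1)) k =
      cochainBilin χ (μ.bracket (leviProj (Pi.single l 1)) (Pi.single i 1)) (Pi.single j 1) k +
        cochainBilin χ (Pi.single i 1) (μ.bracket (leviProj (Pi.single l 1)) (Pi.single j 1)) k :=
  congrFun ((hχ.invariant_leviProj (Pi.single l 1)).lie_apply _ _) k

theorem coeff_eq_zero_of_weight (hχ : IsReducedCocycle χ) {x m : Fin 7 → ℝ}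
    (hx : ∀ y k, μ.bracket x y k = m k * y k) {i j k : Fin 7} (hk : m k ≠ m i + m j) :
    cochainCoeff χ i j k = 0 := by
  have eigen (l : Fin 7) : μ.bracket x (Pi.single l 1) = m l • Pi.single l 1 := by
    ext l'
    rw [hx]
    obtain rfl | hl := eq_or_ne l' l <;> simp [*]
  have h : μ.bracket x (cochainBilin χ (Pi.single i 1) (Pi.single j 1)) =
      cochainBilin χ (μ.bracket x (Pi.single i 1)) (Pi.single j 1) +
        cochainBilin χ (Pi.single i 1) (μ.bracket x (Pi.single j 1)) :=
    (hχ.invariant_of_diagonal x m hx).lie_apply _ _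
  have hk' := congrFun h k
  simp only [hx, eigen, map_smul, LinearMap.smul_apply, Pi.add_apply, Pi.smul_apply,
    smul_eq_mul] at hk'
  refine (mul_eq_zero.1 ?_).resolve_left (sub_ne_zero.2 hk)
  unfold cochainCoeff
  linear_combination hk'

theorem apply_eq_sum_of_weight (hχ : IsReducedCocycle χ) {z m : Fin 7 → ℝ}
    (hz : ∀ y k, μ.bracket z y k = m k * y k) (x y : Fin 7 → ℝ) (k : Fin 7) : cochainBilin χ x y k =
    (if m k = m 3 + m 4 then (x 3 * y 4 - x 4 * y 3) * cochainCoeff χ 3 4 k else 0) +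
    (if m k = m 3 + m 5 then (x 3 * y 5 - x 5 * y 3) * cochainCoeff χ 3 5 k else 0) +
    (if m k = m 3 + m 6 then (x 3 * y 6 - x 6 * y 3) * cochainCoeff χ 3 6 k else 0) +
    (if m k = m 4 + m 5 then (x 4 * y 5 - x 5 * y 4) * cochainCoeff χ 4 5 k else 0) +
    (if m k = m 4 + m 6 then (x 4 * y 6 - x 6 * y 4) * cochainCoeff χ 4 6 k else 0) +
    (if m k = m 5 + m 6 then (x 5 * y 6 - x 6 * y 5) * cochainCoeff χ 5 6 k else 0) := by
  have remove_ite (c : ℝ) (i j : Fin 7) :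
      (if m k = m i + m j then c * cochainCoeff χ i j k else 0) = c * cochainCoeff χ i j k :=
    ite_eq_left_iff.2 fun h => by rw [hχ.coeff_eq_zero_of_weight hz h, mul_zero]
  simp only [remove_ite]
  exact hχ.apply_eq_sum x y k

end IsReducedCocycle

theorem LieLaw.IsLeviSplit.of_so3
    (map_bracket : ∀ x y,
      leviProj (μ.bracket (leviProj x) y) = μ.bracket (leviProj x) (leviProj y))
    (so3 : ∀ x y, μ.bracket (leviProj x) (leviProj y) =
      ![x 1 * y 2 - x 2 * y 1, x 2 * y 0 - x 0 * y 2, x 0 * y 1 - x 1 * y 0, 0, 0, 0, 0])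
    (skew : ∀ x u v, ∑ i, μ.bracket (leviProj x) u i * v i =
      ∑ i, u i * μ.bracket (-leviProj x) v i)
    (eq_zero_of_bracket : ∀ x, (∀ y, μ.bracket x y = 0) → x = 0) :
    μ.IsLeviSplit fun _ => 1 where
  pos _ := one_pos
  map_bracket := map_bracket
  perfect x := by
    refine ⟨![1, 0, 0, 0, 0, 0, 0], ![0, x 2, -x 1, 0, 0, 0, 0],
      ![0, 1, 0, 0, 0, 0, 0], ![0, 0, x 0, 0, 0, 0, 0], ?_⟩
    ext k
    rw [so3, so3]
    fin_cases k <;> simp [leviProj_apply]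
  transpose x := ⟨_, by simpa only [one_mul] using skew x⟩
  eq_zero_of_bracket := eq_zero_of_bracket

/-- The adjoint action is closed under transposition once the squares `w` are scaled so that `X₂`
and `X₃` act by transposed matrices. -/
theorem LieLaw.IsLeviSplit.of_sl2 (pos : ∀ i, 0 < w i)
    (map_bracket : ∀ x y,
      leviProj (μ.bracket (leviProj x) y) = μ.bracket (leviProj x) (leviProj y))
    (sl2 : ∀ x y, μ.bracket (leviProj x) (leviProj y) =
      ![x 1 * y 2 - x 2 * y 1, 2 * (x 0 * y 1 - x 1 * y 0), -2 * (x 0 * y 2 - x 2 * y 0),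
        0, 0, 0, 0])
    (transpose : ∀ x u v, ∑ i, w i * (μ.bracket (leviProj x) u i * v i) =
      ∑ i, w i * (u i * μ.bracket ![x 0, x 2, x 1, 0, 0, 0, 0] v i))
    (eq_zero_of_bracket : ∀ x, (∀ y, μ.bracket x y = 0) → x = 0) : μ.IsLeviSplit w where
  pos := pos
  map_bracket := map_bracket
  perfect x := by
    refine ⟨![1, 0, 0, 0, 0, 0, 0], ![0, x 1 / 2, -(x 2 / 2), 0, 0, 0, 0],
      ![0, 1, 0, 0, 0, 0, 0], ![0, 0, x 0, 0, 0, 0, 0], ?_⟩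
    ext k
    rw [sl2, sl2]
    fin_cases k <;> simp [leviProj_apply] <;> ring
  transpose x := ⟨_, transpose x⟩
  eq_zero_of_bracket := eq_zero_of_bracket

end SevenDimensional

theorem L71_bracket (x y : Fin 7 → ℝ) : L71.bracket x y =
    ![x 1 * y 2 - x 2 * y 1,
      -(x 0 * y 2 - x 2 * y 0),
      x 0 * y 1 - x 1 * y 0,
      (x 1 * y 5 - x 5 * y 1) - (x 2 * y 4 - x 4 * y 2) + (x 3 * y 6 - x 6 * y 3),
      -(x 0 * y 5 - x 5 * y 0) + (x 2 * y 3 - x 3 * y 2) + (x 4 * y 6 - x 6 * y 4),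
      (x 0 * y 4 - x 4 * y 0) - (x 1 * y 3 - x 3 * y 1) + (x 5 * y 6 - x 6 * y 5),
      0] := by
  ext k
  fin_cases k <;>
    simp [LieLaw.bracket, L71, tensorMap_tableTensor, so3Table, coord_seven] <;> ring

theorem L71_isLeviSplit : L71.IsLeviSplit fun _ => 1 := by
  refine .of_so3 (fun x y => ?_) (fun x y => ?_) (fun x u v => ?_) fun x hx => ?_
  · simp [L71_bracket, leviProj_apply]
  · simp [L71_bracket, leviProj_apply]
  · simp [L71_bracket, leviProj_apply, Fin.sum_univ_seven]
    ring
  · have h (i k : Fin 7) := congrFun (hx (Pi.single i 1)) k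
    ext k
    have := h 0 1
    have := h 0 2
    have := h 1 2
    have := h 3 3
    have := h 6 k
    fin_cases k <;> simp [L71_bracket] at * <;> linarith

theorem IsReducedCocycle.exists_d₁₂_eq_L71 {χ : twoCochain ℝ L71.Alg L71.Alg}
    (hχ : IsReducedCocycle χ) : ∃ f, d₁₂ ℝ L71.Alg L71.Alg f = χ := by
  set c := cochainCoeff χ with hc
  have weight (y : Fin 7 → ℝ) (k : Fin 7) :
      L71.bracket (Pi.single 6 1) y k = ![0, 0, 0, -1, -1, -1, 0] k * y k := by
    fin_cases k <;> simp [L71_bracket]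
  have form (x y) (k : Fin 7) : cochainBilin χ x y k = ![0, 0, 0, 1, 1, 1, 0] k *
      ((x 3 * y 6 - x 6 * y 3) * c 3 6 k + (x 4 * y 6 - x 6 * y 4) * c 4 6 k +
        (x 5 * y 6 - x 6 * y 5) * c 5 6 k) := by
    rw [hχ.apply_eq_sum_of_weight weight]
    fin_cases k <;> simp [← hc] <;> norm_num
  have invariant (l i k : Fin 7) := hχ.bracket_apply_single l i 6 k
  have h₃₄ : c 3 6 4 = 0 := by simpa [form, L71_bracket, leviProj_apply] using invariant 0 3 5
  have h₃₅ : c 3 6 5 = 0 := by simpa [form, L71_bracket, leviProj_apply] using invariant 0 3 4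
  have h₄₃ : c 4 6 3 = 0 := by simpa [form, L71_bracket, leviProj_apply] using invariant 1 4 5
  have h₄₅ : c 4 6 5 = 0 := by simpa [form, L71_bracket, leviProj_apply] using invariant 1 4 3
  have h₅₃ : c 5 6 3 = 0 := by simpa [form, L71_bracket, leviProj_apply] using invariant 2 5 4
  have h₅₄ : c 5 6 4 = 0 := by simpa [form, L71_bracket, leviProj_apply] using invariant 2 5 3
  have h₅₅ : c 4 6 4 = c 5 6 5 := by
    simpa [form, L71_bracket, leviProj_apply] using invariant 0 4 5
  have h₄₄ : c 3 6 3 = c 4 6 4 := by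
    simpa [form, L71_bracket, leviProj_apply] using invariant 2 3 4
  refine ⟨_, (d₁₂_eq_iff ((LinearMap.proj 6).smulRight (Pi.single 6 (c 3 6 3)))).2
    fun x y k => ?_⟩
  fin_cases k <;> simp [form, L71_bracket, h₃₄, h₃₅, h₄₃, h₄₅, h₅₃, h₅₄, h₄₄, h₅₅] <;> ring

theorem subsingleton_adjointH2_L71 : Subsingleton (AdjointH2 L71.Alg) :=
  L71_isLeviSplit.subsingleton_adjointH2 fun _ hχ => hχ.exists_d₁₂_eq_L71

theorem L72_bracket (x y : Fin 7 → ℝ) : L72.bracket x y =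
    ![x 1 * y 2 - x 2 * y 1,
      -(x 0 * y 2 - x 2 * y 0),
      x 0 * y 1 - x 1 * y 0,
      (-(x 0 * y 6 - x 6 * y 0) - (x 1 * y 4 - x 4 * y 1) - (x 2 * y 5 - x 5 * y 2)) / 2,
      (-(x 0 * y 5 - x 5 * y 0) + (x 1 * y 3 - x 3 * y 1) + (x 2 * y 6 - x 6 * y 2)) / 2,
      ((x 0 * y 4 - x 4 * y 0) - (x 1 * y 6 - x 6 * y 1) + (x 2 * y 3 - x 3 * y 2)) / 2,
      ((x 0 * y 3 - x 3 * y 0) + (x 1 * y 5 - x 5 * y 1) - (x 2 * y 4 - x 4 * y 2)) / 2] := by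
  ext k
  fin_cases k <;>
    simp [LieLaw.bracket, L72, tensorMap_tableTensor, so3Table, coord_seven] <;> ring

theorem L72_isLeviSplit : L72.IsLeviSplit fun _ => 1 := by
  refine .of_so3 (fun x y => ?_) (fun x y => ?_) (fun x u v => ?_) fun x hx => ?_
  · simp [L72_bracket, leviProj_apply]
  · simp [L72_bracket, leviProj_apply]
  · simp [L72_bracket, leviProj_apply, Fin.sum_univ_seven]
    ring
  · have h (i k : Fin 7) := congrFun (hx (Pi.single i 1)) k
    ext k
    have := h 0 1
    have := h 0 2
    have := h 0 3
    have := h 0 4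
    have := h 0 5
    have := h 0 6
    have := h 1 2
    fin_cases k <;> simp [L72_bracket] at * <;> linarith

theorem L72_apply_eq_zero_of_bracket_single {l k : Fin 7} (hl : l < 3) (hk : k ≠ l)
    {z : Fin 7 → ℝ} (h : ∀ k, L72.bracket (leviProj (Pi.single l 1)) z k = 0) : z k = 0 := by
  have := h 0
  have := h 1
  have := h 2
  have := h 3
  have := h 4
  have := h 5
  have := h 6
  fin_cases l <;> fin_cases k <;> simp [L72_bracket, leviProj_apply] at * <;> linarith

theorem IsReducedCocycle.apply_eq_L72 {χ : twoCochain ℝ L72.Alg L72.Alg}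
    (hχ : IsReducedCocycle χ) (x y : Fin 7 → ℝ) : cochainBilin χ x y =
      ![(x 3 * y 6 - x 6 * y 3) * cochainCoeff χ 3 6 0 +
          (x 4 * y 5 - x 5 * y 4) * cochainCoeff χ 4 5 0,
        (x 3 * y 4 - x 4 * y 3) * cochainCoeff χ 3 4 1 +
          (x 5 * y 6 - x 6 * y 5) * cochainCoeff χ 5 6 1,
        (x 3 * y 5 - x 5 * y 3) * cochainCoeff χ 3 5 2 +
          (x 4 * y 6 - x 6 * y 4) * cochainCoeff χ 4 6 2, 0, 0, 0, 0] := by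
  set c := cochainCoeff χ with hc
  -- The kernel of `ad X₁` is spanned by `X₁`, and `ad X₁` kills `X₄ ∧ X₇` and `X₅ ∧ X₆`; similarly
  -- for `X₂` and `X₃`.
  have kernel {l i j k : Fin 7} (hl : l < 3) (hk : k ≠ l)
      (h : ∀ k, cochainBilin χ (L72.bracket (leviProj (Pi.single l 1)) (Pi.single i 1))
          (Pi.single j 1) k + cochainBilin χ (Pi.single i 1)
          (L72.bracket (leviProj (Pi.single l 1)) (Pi.single j 1)) k = 0) : c i j k = 0 :=
    L72_apply_eq_zero_of_bracket_single hl hk fun k => (hχ.bracket_apply_single l i j k).trans (h k)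
  have h₃₆ (k : Fin 7) (hk : k ≠ 0) : c 3 6 k = 0 :=
    kernel (by decide) hk fun k => by simp [hχ.apply_eq_sum, L72_bracket, leviProj_apply]
  have h₄₅ (k : Fin 7) (hk : k ≠ 0) : c 4 5 k = 0 :=
    kernel (by decide) hk fun k => by simp [hχ.apply_eq_sum, L72_bracket, leviProj_apply]
  have h₃₄ (k : Fin 7) (hk : k ≠ 1) : c 3 4 k = 0 :=
    kernel (by decide) hk fun k => by simp [hχ.apply_eq_sum, L72_bracket, leviProj_apply]
  have h₅₆ (k : Fin 7) (hk : k ≠ 1) : c 5 6 k = 0 :=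
    kernel (by decide) hk fun k => by simp [hχ.apply_eq_sum, L72_bracket, leviProj_apply]
  have h₃₅ (k : Fin 7) (hk : k ≠ 2) : c 3 5 k = 0 :=
    kernel (by decide) hk fun k => by simp [hχ.apply_eq_sum, L72_bracket, leviProj_apply]
  have h₄₆ (k : Fin 7) (hk : k ≠ 2) : c 4 6 k = 0 :=
    kernel (by decide) hk fun k => by simp [hχ.apply_eq_sum, L72_bracket, leviProj_apply]
  ext k
  rw [hχ.apply_eq_sum]
  fin_cases k <;> simp [← hc, h₃₄, h₃₅, h₃₆, h₄₅, h₄₆, h₅₆]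

theorem IsReducedCocycle.exists_d₁₂_eq_L72 {χ : twoCochain ℝ L72.Alg L72.Alg}
    (hχ : IsReducedCocycle χ) : ∃ f, d₁₂ ℝ L72.Alg L72.Alg f = χ := by
  have form := hχ.apply_eq_L72
  have invariant := hχ.bracket_apply_single
  generalize cochainCoeff χ = c at form
  have h₃₄ := invariant 0 3 4 2
  have h₅₆ := invariant 0 5 6 2
  have h₃₅ := invariant 0 3 5 1
  have h₃₆ := invariant 1 3 6 2
  have h₄₅ := invariant 1 4 5 2
  have cocycle := mem_twoCocycle_iff_apply.1 hχ.mem_twoCocycle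
    (Pi.single 3 1) (Pi.single 4 1) (Pi.single 5 1) 6
  simp [form, L72_bracket, leviProj_apply] at h₃₄ h₅₆ h₃₅ h₃₆ h₄₅ cocycle
  have zero : c 3 4 1 = 0 ∧ c 5 6 1 = 0 ∧ c 3 5 2 = 0 ∧ c 4 6 2 = 0 ∧ c 3 6 0 = 0 ∧
      c 4 5 0 = 0 := by
    refine ⟨?_, ?_, ?_, ?_, ?_, ?_⟩ <;> linarith
  refine ⟨_, (d₁₂_eq_iff 0).2 fun x y k => ?_⟩
  fin_cases k <;> simp [form, zero]

theorem subsingleton_adjointH2_L72 : Subsingleton (AdjointH2 L72.Alg) :=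
  L72_isLeviSplit.subsingleton_adjointH2 fun _ hχ => hχ.exists_d₁₂_eq_L72

theorem L73_bracket (p : ℝ) (x y : Fin 7 → ℝ) : (L73 p).bracket x y =
    ![x 1 * y 2 - x 2 * y 1,
      2 * (x 0 * y 1 - x 1 * y 0),
      -2 * (x 0 * y 2 - x 2 * y 0),
      (x 0 * y 3 - x 3 * y 0) + (x 1 * y 4 - x 4 * y 1) + (x 3 * y 6 - x 6 * y 3),
      -(x 0 * y 4 - x 4 * y 0) + (x 2 * y 3 - x 3 * y 2) + (x 4 * y 6 - x 6 * y 4),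
      p * (x 5 * y 6 - x 6 * y 5),
      0] := by
  ext k
  fin_cases k <;>
    simp [LieLaw.bracket, L73, tensorMap_tableTensor, sl2Table, coord_seven] <;> ring

theorem L73_isLeviSplit {p : ℝ} (hp : p ≠ 0) : (L73 p).IsLeviSplit ![2, 1, 1, 1, 1, 1, 1] := by
  refine .of_sl2 (by simp [Fin.forall_fin_succ]) (fun x y => ?_) (fun x y => ?_) (fun x u v => ?_)
    fun x hx => ?_
  · simp [L73_bracket, leviProj_apply]
  · simp [L73_bracket, leviProj_apply]
  · simp [L73_bracket, leviProj_apply, Fin.sum_univ_seven]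
    ring
  · have h (i k : Fin 7) := congrFun (hx (Pi.single i 1)) k
    ext k
    have := h 0 k
    have := h 1 1
    have := h 3 3
    have := h 6 5
    fin_cases k <;> simp [L73_bracket, hp] at * <;> linarith

theorem cochainBilin_phi1 (p : ℝ) (x y : Fin 7 → ℝ) :
    cochainBilin (phi1 p) x y = ![0, 0, 0, 0, 0, x 5 * y 6 - x 6 * y 5, 0] := by
  ext k
  refine (tensorMap_tableTensor _ x y k).trans ?_
  fin_cases k <;> simp [coord_seven]

theorem cochainBilin_phi2 (p : ℝ) (x y : Fin 7 → ℝ) :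
    cochainBilin (phi2 p) x y = ![0, 0, 0, 0, 0, x 3 * y 4 - x 4 * y 3, 0] := by
  ext k
  refine (tensorMap_tableTensor _ x y k).trans ?_
  fin_cases k <;> simp [coord_seven]

theorem IsReducedCocycle.exists_d₁₂_eq_sub_L73 {p : ℝ} (hp : p ≠ 0)
    {χ : twoCochain ℝ (L73 p).Alg (L73 p).Alg} (hχ : IsReducedCocycle χ) :
    ∃ s t : ℝ, (p - 2) * t = 0 ∧
      ∃ f, d₁₂ ℝ (L73 p).Alg (L73 p).Alg f = χ - (s • phi1 p + t • phi2 p) := by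
  set c := cochainCoeff χ with hc
  have weight₁ (y : Fin 7 → ℝ) (k : Fin 7) :
      (L73 p).bracket (Pi.single 0 1) y k = ![0, 2, -2, 1, -1, 0, 0] k * y k := by
    fin_cases k <;> simp [L73_bracket]
  have weight₇ (y : Fin 7 → ℝ) (k : Fin 7) :
      (L73 p).bracket (Pi.single 6 1) y k = ![0, 0, 0, -1, -1, -p, 0] k * y k := by
    fin_cases k <;> simp [L73_bracket]
  have zero {i j k : Fin 7} := hχ.coeff_eq_zero_of_weight weight₇ (i := i) (j := j) (k := k)
  have form (x y) : cochainBilin χ x y =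
      ![0, 0, 0, (x 3 * y 6 - x 6 * y 3) * c 3 6 3, (x 4 * y 6 - x 6 * y 4) * c 4 6 4,
        (x 3 * y 4 - x 4 * y 3) * c 3 4 5 + (x 5 * y 6 - x 6 * y 5) * c 5 6 5, 0] := by
    have h₃₄ (k : Fin 7) (hk : k = 0 ∨ k = 6) : c 3 4 k = 0 :=
      zero (by obtain rfl | rfl := hk <;> simp <;> norm_num)
    have h₅₆ (k : Fin 7) (hk : k = 0 ∨ k = 6) : c 5 6 k = 0 :=
      zero (by obtain rfl | rfl := hk <;> simpa using hp)
    have h₃₅ : c 3 5 3 = 0 := zero (by simpa using hp)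
    have h₄₅ : c 4 5 4 = 0 := zero (by simpa using hp)
    ext k
    rw [hχ.apply_eq_sum_of_weight weight₁]
    fin_cases k <;> simp [← hc, h₃₄, h₅₆, h₃₅, h₄₅] <;> norm_num
  have h₄₆ : c 4 6 4 = c 3 6 3 := by
    simpa [form, L73_bracket, leviProj_apply] using hχ.bracket_apply_single 1 4 6 3
  refine ⟨c 5 6 5 - p * c 3 6 3, c 3 4 5, ?_, _,
    (d₁₂_eq_iff ((LinearMap.proj 6).smulRight (Pi.single 6 (c 3 6 3)))).2 fun x y k => ?_⟩
  · by_cases hp2 : p = 2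
    · simp [hp2]
    · refine mul_eq_zero_of_right _ (zero fun h => hp2 ?_)
      simp at h
      linarith
  · simp only [map_sub, map_add, map_smul, LinearMap.sub_apply, LinearMap.add_apply,
      LinearMap.smul_apply, cochainBilin_phi1, cochainBilin_phi2, form]
    fin_cases k <;> simp [L73_bracket, h₄₆] <;> ring

theorem eq_zero_of_d₁₂_eq_L73 {p s t : ℝ} {f : (Fin 7 → ℝ) →ₗ[ℝ] (Fin 7 → ℝ)}
    (h : d₁₂ ℝ (L73 p).Alg (L73 p).Alg f = s • phi1 p + t • phi2 p) : s = 0 ∧ t = 0 := by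
  have coord (i j k : Fin 7) := (d₁₂_eq_iff f).1 h (Pi.single i 1) (Pi.single j 1) k
  simp only [map_add, map_smul, LinearMap.add_apply, LinearMap.smul_apply, cochainBilin_phi1,
    cochainBilin_phi2] at coord
  have bracket₃₆ : (L73 p).bracket (Pi.single 3 1) (Pi.single 6 1) = Pi.single 3 1 := by
    ext k
    fin_cases k <;> simp [L73_bracket]
  have bracket₄₆ : (L73 p).bracket (Pi.single 4 1) (Pi.single 6 1) = Pi.single 4 1 := by
    ext k
    fin_cases k <;> simp [L73_bracket]
  have bracket₅₆ : (L73 p).bracket (Pi.single 5 1) (Pi.single 6 1) = p • Pi.single 5 1 := by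
    ext k
    fin_cases k <;> simp [L73_bracket]
  have bracket₃₄ : (L73 p).bracket (Pi.single 3 1) (Pi.single 4 1) = 0 := by
    ext k
    fin_cases k <;> simp [L73_bracket]
  have h₃₆ : 0 = -f (Pi.single 6 1) 0 + f (Pi.single 6 1) 6 := by
    simpa [bracket₃₆, L73_bracket] using coord 3 6 3
  have h₄₆ : 0 = f (Pi.single 6 1) 0 + f (Pi.single 6 1) 6 := by
    simpa [bracket₄₆, L73_bracket] using coord 4 6 4
  have h₅₆ : s = p * f (Pi.single 6 1) 6 := by
    simpa [bracket₅₆, L73_bracket] using coord 5 6 5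
  have h₃₄ : t = 0 := by simpa [bracket₃₄, L73_bracket] using coord 3 4 5
  exact ⟨by linear_combination h₅₆ - p / 2 * h₄₆ - p / 2 * h₃₆, h₃₄⟩

theorem phi1_mem_twoCocycle (p : ℝ) : phi1 p ∈ twoCocycle ℝ (L73 p).Alg (L73 p).Alg := by
  refine mem_twoCocycle_iff_apply.2 fun x y z k => ?_
  simp only [cochainBilin_phi1]
  fin_cases k <;> simp [L73_bracket]
  ring

theorem phi2_mem_twoCocycle : phi2 2 ∈ twoCocycle ℝ (L73 2).Alg (L73 2).Alg := by
  refine mem_twoCocycle_iff_apply.2 fun x y z k => ?_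
  simp only [cochainBilin_phi2]
  fin_cases k <;> simp [L73_bracket]
  ring

theorem exists_d₁₂_eq_sub_smul_phi {p : ℝ} (hp : p ≠ 0)
    {φ : twoCochain ℝ (L73 p).Alg (L73 p).Alg} (hφ : φ ∈ twoCocycle ℝ (L73 p).Alg (L73 p).Alg) :
    ∃ s t : ℝ, (p - 2) * t = 0 ∧
      ∃ f, d₁₂ ℝ (L73 p).Alg (L73 p).Alg f = φ - (s • phi1 p + t • phi2 p) := by
  obtain ⟨χ, hχ, g, rfl⟩ := (L73_isLeviSplit hp).exists_isReducedCocycle hφ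
  obtain ⟨s, t, ht, f, hf⟩ := hχ.exists_d₁₂_eq_sub_L73 hp
  exact ⟨s, t, ht, f + g, by rw [map_add, hf]; abel⟩

theorem span_phi1_eq_top {p : ℝ} (hp : p ≠ 0) (hp2 : p ≠ 2) :
    Submodule.span ℝ {cohomologyClass (phi1 p) (phi1_mem_twoCocycle p)} = ⊤ := by
  rw [Submodule.eq_top_iff']
  intro q
  obtain ⟨⟨φ, hφ⟩, rfl⟩ := Submodule.Quotient.mk_surjective _ q
  obtain ⟨s, t, ht, f, hf⟩ := exists_d₁₂_eq_sub_smul_phi hp hφ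
  rw [(mul_eq_zero.1 ht).resolve_left (sub_ne_zero.2 hp2), zero_smul, add_zero] at hf
  refine Submodule.mem_span_singleton.2 ⟨s, (sub_eq_zero.1 ?_).symm⟩
  exact (cohomologyClass_eq_zero_iff (sub_mem hφ
    (Submodule.smul_mem _ s (phi1_mem_twoCocycle p)))).2 ⟨f, hf⟩

theorem finrank_adjointH2_L73 {p : ℝ} (hp : p ≠ 0) (hp2 : p ≠ 2) :
    Module.finrank ℝ (AdjointH2 (L73 p).Alg) = 1 := by
  refine (finrank_eq_one_iff_of_nonzero _ ?_).2 (span_phi1_eq_top hp hp2)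
  rw [Ne, cohomologyClass_eq_zero_iff]
  rintro ⟨f, hf⟩
  refine one_ne_zero (eq_zero_of_d₁₂_eq_L73 (s := 1) (t := 0) (f := f) (hf.trans ?_)).1
  rw [one_smul, zero_smul, add_zero]

theorem span_phi1_phi2_eq_top : Submodule.span ℝ
    {cohomologyClass (phi1 2) (phi1_mem_twoCocycle 2),
      cohomologyClass (phi2 2) phi2_mem_twoCocycle} = ⊤ := by
  rw [Submodule.eq_top_iff']
  intro q
  obtain ⟨⟨φ, hφ⟩, rfl⟩ := Submodule.Quotient.mk_surjective _ q
  obtain ⟨s, t, -, f, hf⟩ := exists_d₁₂_eq_sub_smul_phi two_ne_zero hφ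
  refine Submodule.mem_span_pair.2 ⟨s, t, (sub_eq_zero.1 ?_).symm⟩
  exact (cohomologyClass_eq_zero_iff (sub_mem hφ (add_mem
    (Submodule.smul_mem _ s (phi1_mem_twoCocycle 2))
    (Submodule.smul_mem _ t phi2_mem_twoCocycle)))).2 ⟨f, hf⟩

theorem finrank_adjointH2_L73_two : Module.finrank ℝ (AdjointH2 (L73 2).Alg) = 2 := by
  have independent : LinearIndependent ℝ ![cohomologyClass (phi1 2) (phi1_mem_twoCocycle 2),
      cohomologyClass (phi2 2) phi2_mem_twoCocycle] := by
    refine LinearIndependent.pair_iff.2 fun s t hst => ?_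
    obtain ⟨f, hf⟩ := (cohomologyClass_eq_zero_iff (add_mem
      (Submodule.smul_mem _ s (phi1_mem_twoCocycle 2))
      (Submodule.smul_mem _ t phi2_mem_twoCocycle))).1 hst
    exact eq_zero_of_d₁₂_eq_L73 (f := f) hf
  have h := finrank_span_eq_card independent
  rwa [Matrix.range_cons, Matrix.range_cons, Matrix.range_empty, Set.union_empty,
    Set.singleton_union, span_phi1_phi2_eq_top, finrank_top, Fintype.card_fin] at h

theorem L74_bracket (x y : Fin 7 → ℝ) : L74.bracket x y =
    ![x 1 * y 2 - x 2 * y 1,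
      2 * (x 0 * y 1 - x 1 * y 0),
      -2 * (x 0 * y 2 - x 2 * y 0),
      (x 0 * y 3 - x 3 * y 0) + (x 1 * y 4 - x 4 * y 1) + (x 3 * y 6 - x 6 * y 3),
      -(x 0 * y 4 - x 4 * y 0) + (x 2 * y 3 - x 3 * y 2) + (x 4 * y 6 - x 6 * y 4),
      (x 3 * y 4 - x 4 * y 3) + 2 * (x 5 * y 6 - x 6 * y 5),
      0] := by
  ext k
  fin_cases k <;>
    simp [LieLaw.bracket, L74, tensorMap_tableTensor, sl2Table, coord_seven] <;> ring

theorem L74_isLeviSplit : L74.IsLeviSplit ![2, 1, 1, 1, 1, 1, 1] := by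
  refine .of_sl2 (by simp [Fin.forall_fin_succ]) (fun x y => ?_) (fun x y => ?_) (fun x u v => ?_)
    fun x hx => ?_
  · simp [L74_bracket, leviProj_apply]
  · simp [L74_bracket, leviProj_apply]
  · simp [L74_bracket, leviProj_apply, Fin.sum_univ_seven]
    ring
  · have h (i k : Fin 7) := congrFun (hx (Pi.single i 1)) k
    ext k
    have := h 0 k
    have := h 1 1
    have := h 3 3
    have := h 6 5
    fin_cases k <;> simp [L74_bracket] at * <;> linarith

theorem IsReducedCocycle.exists_d₁₂_eq_L74 {χ : twoCochain ℝ L74.Alg L74.Alg}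
    (hχ : IsReducedCocycle χ) : ∃ f, d₁₂ ℝ L74.Alg L74.Alg f = χ := by
  set c := cochainCoeff χ with hc
  -- `X₁ + 5 X₇` separates the joint weights of the two commuting diagonal elements `X₁`, `X₇`.
  have weight (y : Fin 7 → ℝ) (k : Fin 7) :
      L74.bracket ![1, 0, 0, 0, 0, 0, 5] y k = ![0, 2, -2, -4, -6, -10, 0] k * y k := by
    fin_cases k <;> simp [L74_bracket] <;> ring
  have form (x y) : cochainBilin χ x y =
      ![0, 0, 0, (x 3 * y 6 - x 6 * y 3) * c 3 6 3, (x 4 * y 6 - x 6 * y 4) * c 4 6 4,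
        (x 3 * y 4 - x 4 * y 3) * c 3 4 5 + (x 5 * y 6 - x 6 * y 5) * c 5 6 5, 0] := by
    ext k
    rw [hχ.apply_eq_sum_of_weight weight]
    fin_cases k <;> simp [← hc] <;> norm_num
  have h₄₆ : c 4 6 4 = c 3 6 3 := by
    simpa [form, L74_bracket, leviProj_apply] using hχ.bracket_apply_single 1 4 6 3
  have cocycle := mem_twoCocycle_iff_apply.1 hχ.mem_twoCocycle
    (Pi.single 3 1) (Pi.single 4 1) (Pi.single 6 1) 5
  have h₅₆ : c 5 6 5 = 2 * c 3 6 3 := by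
    simp [form, L74_bracket] at cocycle
    linarith
  refine ⟨_, (d₁₂_eq_iff ((LinearMap.proj 6).smulRight (Pi.single 6 (c 3 6 3)) -
    (LinearMap.proj 5).smulRight (Pi.single 5 (c 3 4 5)))).2 fun x y k => ?_⟩
  fin_cases k <;> simp [form, L74_bracket, h₄₆, h₅₆] <;> ring

theorem subsingleton_adjointH2_L74 : Subsingleton (AdjointH2 L74.Alg) :=
  L74_isLeviSplit.subsingleton_adjointH2 fun _ hχ => hχ.exists_d₁₂_eq_L74

theorem L75_bracket (x y : Fin 7 → ℝ) : L75.bracket x y =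
    ![x 1 * y 2 - x 2 * y 1,
      2 * (x 0 * y 1 - x 1 * y 0),
      -2 * (x 0 * y 2 - x 2 * y 0),
      2 * (x 0 * y 3 - x 3 * y 0) + 2 * (x 1 * y 4 - x 4 * y 1) + (x 3 * y 6 - x 6 * y 3),
      (x 1 * y 5 - x 5 * y 1) + (x 2 * y 3 - x 3 * y 2) + (x 4 * y 6 - x 6 * y 4),
      -2 * (x 0 * y 5 - x 5 * y 0) + 2 * (x 2 * y 4 - x 4 * y 2) + (x 5 * y 6 - x 6 * y 5),
      0] := by
  ext k
  fin_cases k <;>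
    simp [LieLaw.bracket, L75, tensorMap_tableTensor, sl2Table, coord_seven] <;> ring

theorem L75_isLeviSplit : L75.IsLeviSplit ![2, 1, 1, 1, 2, 1, 1] := by
  refine .of_sl2 (by simp [Fin.forall_fin_succ]) (fun x y => ?_) (fun x y => ?_) (fun x u v => ?_)
    fun x hx => ?_
  · simp [L75_bracket, leviProj_apply]
  · simp [L75_bracket, leviProj_apply]
  · simp [L75_bracket, leviProj_apply, Fin.sum_univ_seven]
    ring
  · have h (i k : Fin 7) := congrFun (hx (Pi.single i 1)) k
    ext k
    have := h 0 k
    have := h 1 1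
    have := h 4 4
    have := h 6 4
    fin_cases k <;> simp [L75_bracket] at * <;> linarith

theorem IsReducedCocycle.exists_d₁₂_eq_L75 {χ : twoCochain ℝ L75.Alg L75.Alg}
    (hχ : IsReducedCocycle χ) : ∃ f, d₁₂ ℝ L75.Alg L75.Alg f = χ := by
  set c := cochainCoeff χ with hc
  -- `X₁ + 3 X₇` separates the joint weights of the two commuting diagonal elements `X₁`, `X₇`.
  have weight (y : Fin 7 → ℝ) (k : Fin 7) :
      L75.bracket ![1, 0, 0, 0, 0, 0, 3] y k = ![0, 2, -2, -1, -3, -5, 0] k * y k := by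
    fin_cases k <;> simp [L75_bracket] <;> ring
  have form (x y) : cochainBilin χ x y = ![0, 0, 0, (x 3 * y 6 - x 6 * y 3) * c 3 6 3,
      (x 4 * y 6 - x 6 * y 4) * c 4 6 4, (x 5 * y 6 - x 6 * y 5) * c 5 6 5, 0] := by
    ext k
    rw [hχ.apply_eq_sum_of_weight weight]
    fin_cases k <;> simp [← hc] <;> norm_num
  have invariant := hχ.bracket_apply_single 1
  have h₄₆ : c 4 6 4 = c 3 6 3 := by
    simpa [form, L75_bracket, leviProj_apply] using invariant 4 6 3
  have h₅₆ : c 5 6 5 = c 4 6 4 := by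
    simpa [form, L75_bracket, leviProj_apply] using invariant 5 6 4
  refine ⟨_, (d₁₂_eq_iff ((LinearMap.proj 6).smulRight (Pi.single 6 (c 3 6 3)))).2
    fun x y k => ?_⟩
  fin_cases k <;> simp [form, L75_bracket, h₅₆, h₄₆] <;> ring

theorem subsingleton_adjointH2_L75 : Subsingleton (AdjointH2 L75.Alg) :=
  L75_isLeviSplit.subsingleton_adjointH2 fun _ hχ => hχ.exists_d₁₂_eq_L75

theorem L76_bracket (x y : Fin 7 → ℝ) : L76.bracket x y =
    ![x 1 * y 2 - x 2 * y 1,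
      2 * (x 0 * y 1 - x 1 * y 0),
      -2 * (x 0 * y 2 - x 2 * y 0),
      3 * (x 0 * y 3 - x 3 * y 0) + 3 * (x 1 * y 4 - x 4 * y 1),
      (x 0 * y 4 - x 4 * y 0) + 2 * (x 1 * y 5 - x 5 * y 1) + (x 2 * y 3 - x 3 * y 2),
      -(x 0 * y 5 - x 5 * y 0) + (x 1 * y 6 - x 6 * y 1) + 2 * (x 2 * y 4 - x 4 * y 2),
      -3 * (x 0 * y 6 - x 6 * y 0) + 3 * (x 2 * y 5 - x 5 * y 2)] := by
  ext k
  fin_cases k <;>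
    simp [LieLaw.bracket, L76, tensorMap_tableTensor, sl2Table, coord_seven] <;> ring

theorem L76_isLeviSplit : L76.IsLeviSplit ![2, 1, 1, 1, 3, 3, 1] := by
  refine .of_sl2 (by simp [Fin.forall_fin_succ]) (fun x y => ?_) (fun x y => ?_) (fun x u v => ?_)
    fun x hx => ?_
  · simp [L76_bracket, leviProj_apply]
  · simp [L76_bracket, leviProj_apply]
  · simp [L76_bracket, leviProj_apply, Fin.sum_univ_seven]
    ring
  · have h (i k : Fin 7) := congrFun (hx (Pi.single i 1)) k
    ext k
    have := h 0 k
    have := h 1 1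
    fin_cases k <;> simp [L76_bracket] at * <;> linarith

theorem IsReducedCocycle.exists_d₁₂_eq_L76 {χ : twoCochain ℝ L76.Alg L76.Alg}
    (hχ : IsReducedCocycle χ) : ∃ f, d₁₂ ℝ L76.Alg L76.Alg f = χ := by
  set c := cochainCoeff χ with hc
  have weight (y : Fin 7 → ℝ) (k : Fin 7) :
      L76.bracket (Pi.single 0 1) y k = ![0, 2, -2, 3, 1, -1, -3] k * y k := by
    fin_cases k <;> simp [L76_bracket]
  have form (x y) : cochainBilin χ x y =
      ![(x 3 * y 6 - x 6 * y 3) * c 3 6 0 + (x 4 * y 5 - x 5 * y 4) * c 4 5 0,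
        (x 3 * y 5 - x 5 * y 3) * c 3 5 1, (x 4 * y 6 - x 6 * y 4) * c 4 6 2, 0, 0, 0, 0] := by
    ext k
    rw [hχ.apply_eq_sum_of_weight weight]
    fin_cases k <;> simp [← hc] <;> norm_num
  have invariant := hχ.bracket_apply_single 1
  have h₄₅ : -(2 * c 4 5 0) = 3 * c 3 5 1 := by
    simpa [form, L76_bracket, leviProj_apply] using invariant 4 5 1
  have h₃₆ : -(2 * c 3 6 0) = c 3 5 1 := by
    simpa [form, L76_bracket, leviProj_apply] using invariant 3 6 1
  have h₄₆' : c 4 6 2 = 0 := by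
    simpa [form, L76_bracket, leviProj_apply] using invariant 5 6 2
  have h₄₆ : c 4 6 2 = 3 * c 3 6 0 + c 4 5 0 := by
    simpa [form, L76_bracket, leviProj_apply] using invariant 4 6 0
  have zero : c 3 5 1 = 0 ∧ c 4 5 0 = 0 ∧ c 3 6 0 = 0 := by refine ⟨?_, ?_, ?_⟩ <;> linarith
  refine ⟨_, (d₁₂_eq_iff 0).2 fun x y k => ?_⟩
  fin_cases k <;> simp [form, h₄₆', zero]

theorem subsingleton_adjointH2_L76 : Subsingleton (AdjointH2 L76.Alg) :=
  L76_isLeviSplit.subsingleton_adjointH2 fun _ hχ => hχ.exists_d₁₂_eq_L76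

theorem L77_bracket (x y : Fin 7 → ℝ) : L77.bracket x y =
    ![x 1 * y 2 - x 2 * y 1,
      2 * (x 0 * y 1 - x 1 * y 0),
      -2 * (x 0 * y 2 - x 2 * y 0),
      (x 0 * y 3 - x 3 * y 0) + (x 1 * y 4 - x 4 * y 1),
      -(x 0 * y 4 - x 4 * y 0) + (x 2 * y 3 - x 3 * y 2),
      (x 0 * y 5 - x 5 * y 0) + (x 1 * y 6 - x 6 * y 1),
      -(x 0 * y 6 - x 6 * y 0) + (x 2 * y 5 - x 5 * y 2)] := by
  ext k
  fin_cases k <;>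
    simp [LieLaw.bracket, L77, tensorMap_tableTensor, sl2Table, coord_seven]

theorem L77_isLeviSplit : L77.IsLeviSplit ![2, 1, 1, 1, 1, 1, 1] := by
  refine .of_sl2 (by simp [Fin.forall_fin_succ]) (fun x y => ?_) (fun x y => ?_) (fun x u v => ?_)
    fun x hx => ?_
  · simp [L77_bracket, leviProj_apply]
  · simp [L77_bracket, leviProj_apply]
  · simp [L77_bracket, leviProj_apply, Fin.sum_univ_seven]
    ring
  · have h (i k : Fin 7) := congrFun (hx (Pi.single i 1)) k
    ext k
    have := h 0 k
    have := h 1 1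
    fin_cases k <;> simp [L77_bracket] at * <;> linarith

theorem IsReducedCocycle.exists_d₁₂_eq_L77 {χ : twoCochain ℝ L77.Alg L77.Alg}
    (hχ : IsReducedCocycle χ) : ∃ f, d₁₂ ℝ L77.Alg L77.Alg f = χ := by
  set c := cochainCoeff χ with hc
  have weight (y : Fin 7 → ℝ) (k : Fin 7) :
      L77.bracket (Pi.single 0 1) y k = ![0, 2, -2, 1, -1, 1, -1] k * y k := by
    fin_cases k <;> simp [L77_bracket]
  have form (x y) : cochainBilin χ x y =
      ![(x 3 * y 4 - x 4 * y 3) * c 3 4 0 + (x 3 * y 6 - x 6 * y 3) * c 3 6 0 +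
          (x 4 * y 5 - x 5 * y 4) * c 4 5 0 + (x 5 * y 6 - x 6 * y 5) * c 5 6 0,
        (x 3 * y 5 - x 5 * y 3) * c 3 5 1, (x 4 * y 6 - x 6 * y 4) * c 4 6 2, 0, 0, 0, 0] := by
    ext k
    rw [hχ.apply_eq_sum_of_weight weight]
    fin_cases k <;> simp [← hc] <;> norm_num
  have invariant := hχ.bracket_apply_single 1
  have h₃₄ : c 3 4 0 = 0 := by simpa [form, L77_bracket, leviProj_apply] using invariant 3 4 1
  have h₅₆ : c 5 6 0 = 0 := by simpa [form, L77_bracket, leviProj_apply] using invariant 5 6 1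
  have h₄₅ : -(2 * c 4 5 0) = c 3 5 1 := by
    simpa [form, L77_bracket, leviProj_apply] using invariant 4 5 1
  have h₃₆ : -(2 * c 3 6 0) = c 3 5 1 := by
    simpa [form, L77_bracket, leviProj_apply] using invariant 3 6 1
  have h₄₆ : c 4 6 2 = c 3 6 0 + c 4 5 0 := by
    simpa [form, L77_bracket, leviProj_apply] using invariant 4 6 0
  have cocycle : -c 4 5 0 + c 3 5 1 = 0 := by
    simpa [form, L77_bracket] using
      mem_twoCocycle_iff_apply.1 hχ.mem_twoCocycle (Pi.single 3 1) (Pi.single 4 1) (Pi.single 5 1) 3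
  have zero : c 3 5 1 = 0 ∧ c 4 5 0 = 0 ∧ c 3 6 0 = 0 ∧ c 4 6 2 = 0 := by
    refine ⟨?_, ?_, ?_, ?_⟩ <;> linarith
  refine ⟨_, (d₁₂_eq_iff 0).2 fun x y k => ?_⟩
  fin_cases k <;> simp [form, h₃₄, h₅₆, zero]

theorem subsingleton_adjointH2_L77 : Subsingleton (AdjointH2 L77.Alg) :=
  L77_isLeviSplit.subsingleton_adjointH2 fun _ hχ => hχ.exists_d₁₂_eq_L77

end

theorem proposition4 :
    (∀ μ ∈ ({L71, L72, L74, L75, L76, L77} : Set (LieLaw 7)),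
      Subsingleton (AdjointH2 μ.Alg) ∧ μ.IsStable) ∧
    (∀ p : ℝ, p ≠ 0 → p ≠ 2 →
      Module.finrank ℝ (AdjointH2 (L73 p).Alg) = 1 ∧
      ∃ h₁ : phi1 p ∈ twoCocycle ℝ (L73 p).Alg (L73 p).Alg,
        Submodule.span ℝ {cohomologyClass (phi1 p) h₁} = ⊤) ∧
    (Module.finrank ℝ (AdjointH2 (L73 2).Alg) = 2 ∧
      ∃ (h₁ : phi1 2 ∈ twoCocycle ℝ (L73 2).Alg (L73 2).Alg)
        (h₂ : phi2 2 ∈ twoCocycle ℝ (L73 2).Alg (L73 2).Alg),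
        Submodule.span ℝ {cohomologyClass (phi1 2) h₁, cohomologyClass (phi2 2) h₂} = ⊤) := by
  refine ⟨?_, fun p hp hp2 => ⟨finrank_adjointH2_L73 hp hp2, phi1_mem_twoCocycle p,
    span_phi1_eq_top hp hp2⟩, finrank_adjointH2_L73_two, phi1_mem_twoCocycle 2,
    phi2_mem_twoCocycle, span_phi1_phi2_eq_top⟩
  intro μ hμ
  suffices h : Subsingleton (AdjointH2 μ.Alg) from ⟨h, μ.isStable_of_subsingleton_adjointH2 h⟩
  rcases hμ with rfl | rfl | rfl | rfl | rfl | rfl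
  exacts [subsingleton_adjointH2_L71, subsingleton_adjointH2_L72, subsingleton_adjointH2_L74,
    subsingleton_adjointH2_L75, subsingleton_adjointH2_L76, subsingleton_adjointH2_L77]
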